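/- Let $d\ge 2$ be an integer, let $\Bbbk$ be a field containing a primitive $d$-th root of unity $\zeta$, and put $S_1=\Bbbk[[x_1,\dots,x_a]]$, $S_2=\Bbbk[[y_1,\dots,y_b]]$, $S=\Bbbk[[x_1,\dots,x_a,y_1,\dots,y_b]]$. For a commutative ring $Q$ and $f\in Q$, a ($d$-fold) matrix factorization $(X,\phi)\in \mathrm{MF}^d_Q(f)$ is a $\mathbb Z/d$-graded module $X=\bigoplus_{k\in\mathbb Z/d}X_k$ with all $X_k$ finitely generated projective over $Q$, together with a $Q$-linear map $\phi$ of degree $-1$, with components $\phi_k:X_k\to X_{k-1}$, such that $\phi^d=f\cdot 1_X$; it is also written $X=(\phi_1,\phi_2,\dots,\phi_{d-1},\phi_0)$. An isomorphism is a degree-zero $Q$-linear isomorphism commuting with the maps $\phi$. The shift $TX$ is $(TX)_k=X_{k+1}$ with the correspondingly shifted maps. $X$ is indecomposable if it is nonzero and is not isomorphic to a direct sum of two nonzero matrix factorizations of $f$. If $Q$ is local with maximal ideal $\mathfrak n$, then $X$ is reduced if $\operatorname{Im}\phi_k\subseteq \mathfrak n X_{k-1}$ for all $k$. For $X\in \mathrm{MF}^d_{S_1}(f)$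 and $Y\in \mathrm{MF}^d_{S_2}(g)$, extend scalars to $S$ and let $X\otimes Y\in \mathrm{MF}^d_S(f+g)$ be given by $(X\otimes Y)_k=\bigoplus_{i+j=k}X_i\otimes_S Y_j$ with the map $x\otimes y\mapsto \phi(x)\otimes y+\zeta^{i}\,x\otimes\psi(y)$ for $x\in X_i$, $y\in Y_j$, where $\phi$ and $\psi$ denote the maps of $X$ and $Y$. **Theorem 5.7.** Let $u_1,\dots,u_{d-1},u_0$ be pairwise relatively prime elements of the maximal ideal of $S_1$ (for $i\ne j$, every common divisor of $u_i$ and $u_j$ is a unit), and let $X=(u_1,\dots,u_{d-1},u_0)\in \mathrm{MF}^d_{S_1}(u_1\cdots u_{d-1}u_0)$ be the matrix factorization with $X_k=S_1$ for all $k$ and $\phi_k$ multiplication by $u_k$. Let $g\in S_2$ be a nonzero non-unit and let $Y\in \mathrm{MF}^d_{S_2}(g)$ be an indecomposable reduced matrix factorization with $Y\cong TY$. Then $X\otimes Y$ is indecomposable. -/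

import Mathlib

open scoped DirectSum TensorProduct

universe w

noncomputable section

/-! ### Cyclically graded modules with a map of degree `-1` -/

section Total

variable {Q : Type w} [CommRing Q] {d : ℕ} {X : ZMod d → Type w}
  [∀ i, AddCommGroup (X i)] [∀ i, Module Q (X i)]

/-- The endomorphism of `⨁ i, X i` assembled from maps `φ i j : X i → X j`, where `i = j + 1`. -/
def totalMap (φ : ∀ i j : ZMod d, i = j + 1 → (X i →ₗ[Q] X j)) : Module.End Q (⨁ i, X i) :=
  DirectSum.toModule Q (ZMod d) (⨁ i, X i) fun i =>
    DirectSum.lof Q (ZMod d) X (i - 1) ∘ₗ φ i (i - 1) (sub_add_cancel i 1).symm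

theorem totalMap_lof (φ : ∀ i j : ZMod d, i = j + 1 → (X i →ₗ[Q] X j)) (i j : ZMod d)
    (h : i = j + 1) (x : X i) :
    totalMap φ (DirectSum.lof Q (ZMod d) X i x) = DirectSum.lof Q (ZMod d) X j (φ i j h x) := by
  obtain rfl : j = i - 1 := by rw [h]; ring
  simp [totalMap]

end Total

/-- An additive map that intertwines two functions intertwines their iterates. -/
theorem intertwine_iterate {R R' M N : Type*} [Semiring R] [Semiring R'] [AddCommMonoid M]
    [AddCommMonoid N] [Module R M] [Module R' N] (A : Module.End R M) (B : Module.End R' N)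
    (F : M → N) (h : ∀ m, F (A m) = B (F m)) (n : ℕ) (m : M) : F ((A ^ n) m) = (B ^ n) (F m) := by
  induction n generalizing m with
  | zero => simp
  | succ n ih => rw [pow_succ, pow_succ, Module.End.mul_apply, Module.End.mul_apply, ih, h]

/-! ### Matrix factorizations -/

/-- A matrix factorization of `f` with `d` factors: a `ℤ/d`-graded finitely generated projective
module `X` with a map `φ` of degree `-1` such that `φ ^ d = f • 1`. The component
`φ i j _ : X i → X j` is indexed by a pair of degrees with `i = j + 1`. -/
structure MatFac (Q : Type w) [CommRing Q] (d : ℕ) (f : Q) where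
  X : ZMod d → Type w
  [addCommGroup : ∀ i, AddCommGroup (X i)]
  [module : ∀ i, Module Q (X i)]
  [finite : ∀ i, Module.Finite Q (X i)]
  [projective : ∀ i, Module.Projective Q (X i)]
  φ : ∀ i j : ZMod d, i = j + 1 → (X i →ₗ[Q] X j)
  total_pow : totalMap φ ^ d = f • (1 : Module.End Q (⨁ i, X i))

namespace MatFac

attribute [instance] addCommGroup module finite projective

section Basic

variable {Q : Type w} [CommRing Q] {d : ℕ} {f : Q}

/-- An isomorphism of matrix factorizations: an isomorphism in each degree, compatible with the
maps. -/
structure Iso (X Y : MatFac Q d f) where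
  equiv : ∀ i, X.X i ≃ₗ[Q] Y.X i
  comm : ∀ (i j : ZMod d) (h : i = j + 1) (x : X.X i),
    equiv j (X.φ i j h x) = Y.φ i j h (equiv i x)

/-- The shift `T X`, with `(T X) i = X (i + 1)`. -/
def shift (X : MatFac Q d f) : MatFac Q d f where
  X i := X.X (i + 1)
  φ i j h := X.φ (i + 1) (j + 1) (by rw [h])
  total_pow := by
    let G : (⨁ i, X.X (i + 1)) →ₗ[Q] ⨁ i, X.X i :=
      DirectSum.toModule Q (ZMod d) _ fun i => DirectSum.lof Q (ZMod d) X.X (i + 1)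
    have hG : ∀ i x, G (DirectSum.lof Q (ZMod d) (fun i => X.X (i + 1)) i x) =
        DirectSum.lof Q (ZMod d) X.X (i + 1) x := fun i x => by simp [G]
    have hcomp : ∀ v i, DirectSum.component Q (ZMod d) X.X (i + 1) (G v) =
        DirectSum.component Q (ZMod d) (fun i => X.X (i + 1)) i v := by
      intro v i
      refine LinearMap.congr_fun (f := DirectSum.component Q (ZMod d) X.X (i + 1) ∘ₗ G) ?_ v
      refine DirectSum.linearMap_ext Q fun j => LinearMap.ext fun x => ?_
      by_cases hij : j = i
      · subst hij
        simp [hG, DirectSum.component.lof_self]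
      · have hij' : j + 1 ≠ i + 1 := fun h => hij (add_right_cancel h)
        simp [hG, DirectSum.component.of, hij, hij']
    have hinj : Function.Injective G := by
      intro v w h
      refine DirectSum.ext_component Q fun i => ?_
      rw [← hcomp, ← hcomp, h]
    have hGφ : ∀ v, G (totalMap (X := fun i => X.X (i + 1))
        (fun i j h => X.φ (i + 1) (j + 1) (by rw [h])) v) = totalMap X.φ (G v) := by
      intro v
      refine LinearMap.congr_fun (f := G ∘ₗ totalMap (X := fun i => X.X (i + 1))
        (fun i j h => X.φ (i + 1) (j + 1) (by rw [h]))) (g := totalMap X.φ ∘ₗ G) ?_ v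
      refine DirectSum.linearMap_ext Q fun i => LinearMap.ext fun x => ?_
      simp only [LinearMap.comp_apply, hG]
      rw [totalMap_lof _ i (i - 1) (by ring), totalMap_lof _ (i + 1) (i - 1 + 1) (by ring), hG]
    refine LinearMap.ext fun v => hinj ?_
    rw [intertwine_iterate _ _ G hGφ, X.total_pow]
    simp

/-- The direct sum of two matrix factorizations of the same element. -/
def directSum (X Y : MatFac Q d f) : MatFac Q d f where
  X i := X.X i × Y.X i
  φ i j h := (X.φ i j h).prodMap (Y.φ i j h)
  total_pow := by
    let F : (⨁ i, X.X i) →ₗ[Q] ⨁ i, (X.X i × Y.X i) :=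
      DirectSum.toModule Q (ZMod d) _ fun i =>
        DirectSum.lof Q (ZMod d) (fun i => X.X i × Y.X i) i ∘ₗ LinearMap.inl Q _ _
    let G : (⨁ i, Y.X i) →ₗ[Q] ⨁ i, (X.X i × Y.X i) :=
      DirectSum.toModule Q (ZMod d) _ fun i =>
        DirectSum.lof Q (ZMod d) (fun i => X.X i × Y.X i) i ∘ₗ LinearMap.inr Q _ _
    set Ψ := totalMap (X := fun i => X.X i × Y.X i)
      (fun i j h => (X.φ i j h).prodMap (Y.φ i j h)) with hΨ
    have hF : ∀ v, F (totalMap X.φ v) = Ψ (F v) := by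
      intro v
      refine LinearMap.congr_fun (f := F ∘ₗ totalMap X.φ) (g := Ψ ∘ₗ F) ?_ v
      refine DirectSum.linearMap_ext Q fun i => LinearMap.ext fun x => ?_
      simp only [LinearMap.comp_apply]
      rw [totalMap_lof _ i (i - 1) (by ring)]
      simp only [F, DirectSum.toModule_lof, LinearMap.comp_apply]
      rw [hΨ, totalMap_lof _ i (i - 1) (by ring)]
      simp
    have hG : ∀ v, G (totalMap Y.φ v) = Ψ (G v) := by
      intro v
      refine LinearMap.congr_fun (f := G ∘ₗ totalMap Y.φ) (g := Ψ ∘ₗ G) ?_ v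
      refine DirectSum.linearMap_ext Q fun i => LinearMap.ext fun x => ?_
      simp only [LinearMap.comp_apply]
      rw [totalMap_lof _ i (i - 1) (by ring)]
      simp only [G, DirectSum.toModule_lof, LinearMap.comp_apply]
      rw [hΨ, totalMap_lof _ i (i - 1) (by ring)]
      simp
    refine DirectSum.linearMap_ext Q fun i => LinearMap.ext fun p => ?_
    obtain ⟨x, y⟩ := p
    have hxy : DirectSum.lof Q (ZMod d) (fun i => X.X i × Y.X i) i (x, y) =
        F (DirectSum.lof Q (ZMod d) X.X i x) + G (DirectSum.lof Q (ZMod d) Y.X i y) := by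
      simp only [F, G, DirectSum.toModule_lof, LinearMap.comp_apply]
      rw [← map_add]
      simp
    simp only [LinearMap.comp_apply]
    rw [hxy, map_add, ← intertwine_iterate _ _ F hF, ← intertwine_iterate _ _ G hG, X.total_pow,
      Y.total_pow]
    simp

/-- A matrix factorization is zero if all of its modules are. -/
def IsZero (X : MatFac Q d f) : Prop := ∀ i, Subsingleton (X.X i)

/-- A nonzero matrix factorization that is not isomorphic to a direct sum of two nonzero ones. -/
def Indecomposable (X : MatFac Q d f) : Prop :=
  ¬ X.IsZero ∧ ∀ A B : MatFac Q d f, Nonempty (X.Iso (A.directSum B)) → A.IsZero ∨ B.IsZero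

/-- A matrix factorization over a local ring with maximal ideal `𝔫` is reduced if
`Im (X i → X j) ⊆ 𝔫 X j` for all its maps. -/
def IsReduced [IsLocalRing Q] (X : MatFac Q d f) : Prop :=
  ∀ (i j : ZMod d) (h : i = j + 1),
    LinearMap.range (X.φ i j h) ≤ IsLocalRing.maximalIdeal Q • (⊤ : Submodule Q (X.X j))

end Basic

/-- The factorization `(u 1, u 2, …, u (d - 1), u 0)` of rank one of the product of the `u i`:
every module is `Q`, and the map from degree `i` to degree `i - 1` is multiplication by `u i`. -/
def rankOne {Q : Type w} [CommRing Q] {d : ℕ} [NeZero d] (u : ZMod d → Q) :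
    MatFac Q d (∏ i, u i) where
  X _ := Q
  φ i _ _ := LinearMap.mulLeft Q (u i)
  total_pow := by
    have key : ∀ (n : ℕ) (i : ZMod d) (x : Q),
        (totalMap (X := fun _ => Q) (fun i _ _ => LinearMap.mulLeft Q (u i)) ^ n)
          (DirectSum.lof Q (ZMod d) (fun _ => Q) i x) =
        DirectSum.lof Q (ZMod d) (fun _ => Q) (i - n)
          ((∏ t ∈ Finset.range n, u (i - t)) * x) := by
      intro n
      induction n with
      | zero => intro i x; simp
      | succ n ih =>
        intro i x
        rw [pow_succ', Module.End.mul_apply, ih,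
          totalMap_lof _ (i - (n : ZMod d)) (i - ((n + 1 : ℕ) : ZMod d)) (by push_cast; ring), Finset.prod_range_succ]
        congr 1
        simp only [LinearMap.mulLeft_apply]
        ring
    have hprod : ∀ i : ZMod d, ∏ t ∈ Finset.range d, u (i - t) = ∏ j, u j := by
      intro i
      refine Finset.prod_bij (fun t _ => i - (t : ZMod d)) (fun _ _ => Finset.mem_univ _) ?_ ?_
        (fun _ _ => rfl)
      · intro s hs t ht h
        have h' : (s : ZMod d) = t := sub_right_injective h
        rw [ZMod.natCast_eq_natCast_iff'] at h'
        rwa [Nat.mod_eq_of_lt (Finset.mem_range.1 hs), Nat.mod_eq_of_lt (Finset.mem_range.1 ht)]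
          at h'
      · intro j _
        exact ⟨(i - j).val, Finset.mem_range.2 (ZMod.val_lt _), by simp⟩
    refine DirectSum.linearMap_ext Q fun i => LinearMap.ext fun x => ?_
    simp only [LinearMap.comp_apply]
    rw [key, hprod]
    simp [← map_smul]

/-- The base change `Q ⊗ X` of a matrix factorization of `f` along a ring homomorphism
`ρ : R → Q`, a matrix factorization of `ρ f`. -/
def baseChange {R Q : Type w} [CommRing R] [CommRing Q] {d : ℕ} {f : R} (ρ : R →+* Q)
    (X : MatFac R d f) : MatFac Q d (ρ f) :=
  letI : Algebra R Q := ρ.toAlgebra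
  { X := fun i => Q ⊗[R] X.X i
    φ := fun i j h => (X.φ i j h).baseChange Q
    total_pow := by
      set Ψ := totalMap (X := fun i => Q ⊗[R] X.X i)
        (fun i j h => (X.φ i j h).baseChange Q) with hΨ
      have key : ∀ q : Q, ∃ F : (⨁ i, X.X i) →+ ⨁ i, (Q ⊗[R] X.X i),
          (∀ i x, F (DirectSum.lof R (ZMod d) X.X i x) =
            DirectSum.lof Q (ZMod d) (fun i => Q ⊗[R] X.X i) i (q ⊗ₜ x)) ∧
          ∀ v, F (totalMap X.φ v) = Ψ (F v) := by
        intro q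
        let F : (⨁ i, X.X i) →+ ⨁ i, (Q ⊗[R] X.X i) := DirectSum.toAddMonoid fun i =>
          ((DirectSum.lof Q (ZMod d) (fun i => Q ⊗[R] X.X i) i).toAddMonoidHom).comp
            (TensorProduct.mk R Q (X.X i) q).toAddMonoidHom
        have hF : ∀ i x, F (DirectSum.lof R (ZMod d) X.X i x) =
            DirectSum.lof Q (ZMod d) (fun i => Q ⊗[R] X.X i) i (q ⊗ₜ x) := by
          intro i x
          simp [F, DirectSum.lof_eq_of]
        refine ⟨F, hF, fun v => ?_⟩
        induction v using DirectSum.induction_on with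
        | zero => simp
        | of i x =>
          rw [← DirectSum.lof_eq_of R, totalMap_lof _ i (i - 1) (by ring), hF, hF, hΨ,
            totalMap_lof _ i (i - 1) (by ring)]
          simp
        | add v w hv hw => simp only [map_add, hv, hw]
      refine DirectSum.linearMap_ext Q fun i => LinearMap.ext fun t => ?_
      simp only [LinearMap.comp_apply]
      induction t using TensorProduct.induction_on with
      | zero => simp
      | tmul q x =>
        obtain ⟨F, hF, hFΨ⟩ := key q
        rw [← hF, ← intertwine_iterate _ _ F hFΨ, X.total_pow]
        simp only [LinearMap.smul_apply, Module.End.one_apply]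
        rw [← map_smul, hF, hF, ← map_smul, TensorProduct.tmul_smul]
        congr 1
      | add s t hs ht => simp only [map_add, hs, ht] }

end MatFac

/-! ### The `q`-binomial formula at a root of unity -/

section QBinomial

variable {Q : Type w} [CommRing Q] (z : Q)

/-- The Gaussian binomial coefficient "`i + j` choose `j`" at `z`. -/
def qChoose : ℕ → ℕ → Q
  | 0, _ => 1
  | _ + 1, 0 => 1
  | i + 1, j + 1 => z ^ (j + 1) * qChoose i (j + 1) + qChoose (i + 1) j

/-- The `q`-integer `1 + z + ⋯ + z ^ (n - 1)`. -/
def qInt (n : ℕ) : Q := ∑ i ∈ Finset.range n, z ^ i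

/-- The `q`-factorial. -/
def qFact (n : ℕ) : Q := ∏ i ∈ Finset.range n, qInt z (i + 1)

theorem qChoose_zero_right (i : ℕ) : qChoose z i 0 = 1 := by
  cases i <;> simp [qChoose]

theorem qInt_add (m n : ℕ) : qInt z (m + n) = qInt z m + z ^ m * qInt z n := by
  simp [qInt, Finset.sum_range_add, pow_add, Finset.mul_sum]

theorem qFact_succ (n : ℕ) : qFact z (n + 1) = qFact z n * qInt z (n + 1) :=
  Finset.prod_range_succ _ _

theorem qChoose_mul (i j : ℕ) : qChoose z i j * (qFact z i * qFact z j) = qFact z (i + j) := by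
  induction i generalizing j with
  | zero => simp [qChoose, qFact]
  | succ i ihi =>
    induction j with
    | zero => simp [qChoose, qFact]
    | succ j ihj =>
      have h1 := ihi (j + 1)
      have h2 : qFact z (i + 1 + (j + 1)) = qFact z (i + (j + 1)) * qInt z (j + 1 + (i + 1)) := by
        rw [show i + 1 + (j + 1) = (i + (j + 1)) + 1 by ring, qFact_succ]
        congr 2; ring
      have h3 : qFact z (i + (j + 1)) = qFact z (i + 1 + j) := by congr 1; ring
      rw [h2, qInt_add, qChoose]
      rw [← h3] at ihj
      rw [qFact_succ] at h1 ⊢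
      rw [qFact_succ z j]
      rw [qFact_succ] at ihj
      linear_combination z ^ (j + 1) * qInt z (i + 1) * h1 + qInt z (j + 1) * ihj

theorem qChoose_eq_zero [IsDomain Q] {d : ℕ} (hz : IsPrimitiveRoot z d) {i j : ℕ}
    (h : i + 1 + (j + 1) = d) : qChoose z (i + 1) (j + 1) = 0 := by
  have hne : z ≠ 1 := by
    rintro rfl
    have := hz.dvd_of_pow_eq_one 1 (by simp)
    have := Nat.le_of_dvd one_pos this
    omega
  have hq : ∀ n, qInt z n * (z - 1) = z ^ n - 1 := fun n => geom_sum_mul z n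
  have hpos : ∀ n, n < d → qFact z n ≠ 0 := by
    intro n hn
    refine Finset.prod_ne_zero_iff.2 fun t ht h0 => ?_
    have h1 := hq (t + 1)
    rw [h0, zero_mul] at h1
    have h2 := Nat.le_of_dvd (by omega) (hz.dvd_of_pow_eq_one _ (sub_eq_zero.1 h1.symm))
    have := Finset.mem_range.1 ht
    omega
  have hd : qFact z d = 0 := by
    refine Finset.prod_eq_zero (i := d - 1) (Finset.mem_range.2 (by omega)) ?_
    have h1 := hq (d - 1 + 1)
    rw [show d - 1 + 1 = d by omega, hz.pow_eq_one, sub_self] at h1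
    rw [show d - 1 + 1 = d by omega]
    exact (mul_eq_zero.1 h1).resolve_right (sub_ne_zero.2 hne)
  have h1 := qChoose_mul z (i + 1) (j + 1)
  rw [h, hd] at h1
  exact (mul_eq_zero.1 h1).resolve_right
    (mul_ne_zero (hpos _ (by omega)) (hpos _ (by omega)))

theorem add_pow_of_qcomm {E : Type*} [Ring E] [Algebra Q E] (A B : E) (h : A * B = z • (B * A))
    (n : ℕ) : (A + B) ^ n =
      ∑ p ∈ Finset.HasAntidiagonal.antidiagonal n, qChoose z p.1 p.2 • (B ^ p.2 * A ^ p.1) := by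
  have hAB : ∀ j, A * B ^ j = z ^ j • (B ^ j * A) := by
    intro j
    induction j with
    | zero => simp
    | succ j ih =>
      rw [pow_succ, ← mul_assoc, ih, smul_mul_assoc, mul_assoc, h, mul_smul_comm, smul_smul,
        ← mul_assoc, pow_succ]
  induction n with
  | zero => simp [qChoose]
  | succ n ih =>
    let r₁ : ℕ × ℕ → Q := fun p =>
      match p with
      | (0, _) => 0
      | (i + 1, j) => z ^ j * qChoose z i j
    let r₂ : ℕ × ℕ → Q := fun p =>
      match p with
      | (_, 0) => 0
      | (i, j + 1) => qChoose z i j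
    have hr : ∀ p ∈ Finset.HasAntidiagonal.antidiagonal (n + 1), qChoose z p.1 p.2 = r₁ p + r₂ p := by
      rintro ⟨i, j⟩ hp
      rw [Finset.HasAntidiagonal.mem_antidiagonal] at hp
      rcases i with _ | i <;> rcases j with _ | j
      · simp at hp
      · simp [r₁, r₂, qChoose]
      · simp [r₁, r₂, qChoose_zero_right]
      · simp [r₁, r₂, qChoose]
    have e₁ : ∑ p ∈ Finset.HasAntidiagonal.antidiagonal (n + 1), r₁ p • (B ^ p.2 * A ^ p.1) =
        A * ∑ p ∈ Finset.HasAntidiagonal.antidiagonal n, qChoose z p.1 p.2 • (B ^ p.2 * A ^ p.1) := by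
      rw [Finset.Nat.sum_antidiagonal_succ, Finset.mul_sum]
      simp only [r₁, zero_smul, zero_add]
      refine Finset.sum_congr rfl fun p _ => ?_
      rw [mul_smul_comm, ← mul_assoc, hAB, smul_mul_assoc, smul_smul, mul_assoc, ← pow_succ',
        mul_comm]
    have e₂ : ∑ p ∈ Finset.HasAntidiagonal.antidiagonal (n + 1), r₂ p • (B ^ p.2 * A ^ p.1) =
        B * ∑ p ∈ Finset.HasAntidiagonal.antidiagonal n, qChoose z p.1 p.2 • (B ^ p.2 * A ^ p.1) := by
      rw [Finset.Nat.sum_antidiagonal_succ', Finset.mul_sum]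
      simp only [r₂, zero_smul, zero_add]
      refine Finset.sum_congr rfl fun p _ => ?_
      rw [mul_smul_comm, ← mul_assoc, ← pow_succ']
    rw [pow_succ', ih, add_mul, ← e₁, ← e₂, ← Finset.sum_add_distrib]
    refine Finset.sum_congr rfl fun p hp => ?_
    rw [hr p hp, add_smul]

theorem add_pow_of_qcomm_primitiveRoot [IsDomain Q] {E : Type*} [Ring E] [Algebra Q E] {d : ℕ}
    [NeZero d] (hz : IsPrimitiveRoot z d) (A B : E) (h : A * B = z • (B * A)) :
    (A + B) ^ d = A ^ d + B ^ d := by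
  obtain ⟨e, rfl⟩ := Nat.exists_eq_succ_of_ne_zero (NeZero.ne d)
  rw [add_pow_of_qcomm z A B h, Finset.Nat.sum_antidiagonal_succ]
  rcases e with _ | e
  · simp [qChoose, add_comm]
  · rw [Finset.Nat.sum_antidiagonal_succ', Finset.sum_eq_zero]
    · simp [qChoose, qChoose_zero_right, add_comm, add_left_comm]
    · rintro ⟨i, j⟩ hp
      rw [Finset.HasAntidiagonal.mem_antidiagonal] at hp
      simp only at hp ⊢
      rw [qChoose_eq_zero z hz (i := i) (j := j) (by omega), zero_smul]

end QBinomial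

/-! ### The tensor product -/

namespace MatFac

section Tensor

variable {Q : Type w} [CommRing Q] {d : ℕ} {f g : Q}

/-- The degree `k` part `⨁_{i + j = k} X i ⊗ Y j` of the tensor product. -/
abbrev TensorX (X : MatFac Q d f) (Y : MatFac Q d g) (k : ZMod d) : Type w :=
  ⨁ p : {p : ZMod d × ZMod d // p.1 + p.2 = k}, X.X p.1.1 ⊗[Q] Y.X p.1.2

/-- The inclusion of the summand `X i ⊗ Y j` in degree `k = i + j`. -/
def tensorIncl (X : MatFac Q d f) (Y : MatFac Q d g) (i j k : ZMod d) (h : i + j = k) :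
    X.X i ⊗[Q] Y.X j →ₗ[Q] TensorX X Y k :=
  DirectSum.lof Q {p : ZMod d × ZMod d // p.1 + p.2 = k}
    (fun p => X.X p.1.1 ⊗[Q] Y.X p.1.2) ⟨(i, j), h⟩

/-- The map `x ⊗ y ↦ φ x ⊗ y`. -/
def tensorLeft (X : MatFac Q d f) (Y : MatFac Q d g) (k l : ZMod d) (h : k = l + 1) :
    TensorX X Y k →ₗ[Q] TensorX X Y l :=
  DirectSum.toModule Q _ _ fun p =>
    tensorIncl X Y (p.1.1 - 1) p.1.2 l (by rw [sub_add_eq_add_sub, p.2, h]; ring) ∘ₗ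
      (X.φ p.1.1 (p.1.1 - 1) (sub_add_cancel _ _).symm).rTensor (Y.X p.1.2)

/-- The map `x ⊗ y ↦ ζ ^ |x| • (x ⊗ ψ y)`. -/
def tensorRight (ζ : Q) (X : MatFac Q d f) (Y : MatFac Q d g) (k l : ZMod d) (h : k = l + 1) :
    TensorX X Y k →ₗ[Q] TensorX X Y l :=
  DirectSum.toModule Q _ _ fun p =>
    ζ ^ (p.1.1).val • tensorIncl X Y p.1.1 (p.1.2 - 1) l
        (by rw [← add_sub_assoc, p.2, h]; ring) ∘ₗ
      (Y.φ p.1.2 (p.1.2 - 1) (sub_add_cancel _ _).symm).lTensor (X.X p.1.1)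

theorem tensorLeft_incl (X : MatFac Q d f) (Y : MatFac Q d g) (i i' j k l : ZMod d)
    (h : k = l + 1) (hk : i + j = k) (hi : i = i' + 1) (hl : i' + j = l) (x : X.X i) (y : Y.X j) :
    tensorLeft X Y k l h (tensorIncl X Y i j k hk (x ⊗ₜ y)) =
      tensorIncl X Y i' j l hl (X.φ i i' hi x ⊗ₜ y) := by
  obtain rfl : i' = i - 1 := by rw [hi]; ring
  rw [tensorLeft, tensorIncl, DirectSum.toModule_lof]
  simp

theorem tensorRight_incl (ζ : Q) (X : MatFac Q d f) (Y : MatFac Q d g) (i j j' k l : ZMod d)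
    (h : k = l + 1) (hk : i + j = k) (hj : j = j' + 1) (hl : i + j' = l) (x : X.X i) (y : Y.X j) :
    tensorRight ζ X Y k l h (tensorIncl X Y i j k hk (x ⊗ₜ y)) =
      ζ ^ i.val • tensorIncl X Y i j' l hl (x ⊗ₜ Y.φ j j' hj y) := by
  obtain rfl : j' = j - 1 := by rw [hj]; ring
  rw [tensorRight, tensorIncl, DirectSum.toModule_lof]
  simp

/-- The element `x ⊗ y` of the total module of the tensor product. -/
def tensorElem (X : MatFac Q d f) (Y : MatFac Q d g) (i j : ZMod d) :
    X.X i →ₗ[Q] Y.X j →ₗ[Q] ⨁ k, TensorX X Y k :=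
  (TensorProduct.mk Q (X.X i) (Y.X j)).compr₂
    (DirectSum.lof Q (ZMod d) (TensorX X Y) (i + j) ∘ₗ tensorIncl X Y i j (i + j) rfl)

theorem tensorElem_eq (X : MatFac Q d f) (Y : MatFac Q d g) (i j k : ZMod d) (h : i + j = k)
    (x : X.X i) (y : Y.X j) :
    tensorElem X Y i j x y =
      DirectSum.lof Q (ZMod d) (TensorX X Y) k (tensorIncl X Y i j k h (x ⊗ₜ y)) := by
  subst h
  rfl

theorem tensor_hom_ext (X : MatFac Q d f) (Y : MatFac Q d g)
    {A B : Module.End Q (⨁ k, TensorX X Y k)}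
    (h : ∀ i j x y, A (tensorElem X Y i j x y) = B (tensorElem X Y i j x y)) : A = B := by
  refine DirectSum.linearMap_ext Q fun k => ?_
  refine DirectSum.linearMap_ext Q fun ⟨⟨i, j⟩, hk⟩ => ?_
  refine TensorProduct.ext' fun x y => ?_
  have := h i j x y
  rw [tensorElem_eq X Y i j k hk] at this
  exact this

theorem totalMap_left (X : MatFac Q d f) (Y : MatFac Q d g) (i i' j : ZMod d) (hi : i = i' + 1)
    (x : X.X i) (y : Y.X j) :
    totalMap (tensorLeft X Y) (tensorElem X Y i j x y) = tensorElem X Y i' j (X.φ i i' hi x) y := by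
  have hl : i + j = i' + j + 1 := by rw [hi]; ring
  rw [tensorElem_eq X Y i j _ rfl, totalMap_lof _ (i + j) (i' + j) hl,
    tensorLeft_incl X Y i i' j _ _ hl rfl hi rfl, tensorElem_eq X Y i' j _ rfl]

theorem totalMap_right (ζ : Q) (X : MatFac Q d f) (Y : MatFac Q d g) (i j j' : ZMod d)
    (hj : j = j' + 1) (x : X.X i) (y : Y.X j) :
    totalMap (tensorRight ζ X Y) (tensorElem X Y i j x y) =
      ζ ^ i.val • tensorElem X Y i j' x (Y.φ j j' hj y) := by
  have hl : i + j = i + j' + 1 := by rw [hj]; ring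
  rw [tensorElem_eq X Y i j _ rfl, totalMap_lof _ (i + j) (i + j') hl,
    tensorRight_incl ζ X Y i j j' _ _ hl rfl hj rfl, tensorElem_eq X Y i j' _ rfl, map_smul]

theorem pow_val_succ [NeZero d] {ζ : Q} (hζ : ζ ^ d = 1) (i i' : ZMod d) (hi : i = i' + 1) :
    ζ ^ i.val = ζ * ζ ^ i'.val := by
  have h : i.val = (i'.val + 1) % d := by
    rw [hi, ← ZMod.val_natCast]
    simp
  rw [h, ← pow_eq_pow_mod _ hζ, pow_succ']

theorem totalMap_left_pow (X : MatFac Q d f) (Y : MatFac Q d g) :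
    totalMap (tensorLeft X Y) ^ d = f • (1 : Module.End Q (⨁ k, TensorX X Y k)) := by
  refine tensor_hom_ext X Y fun i j x y => ?_
  let F : (⨁ i, X.X i) →ₗ[Q] ⨁ k, TensorX X Y k :=
    DirectSum.toModule Q (ZMod d) _ fun i => (tensorElem X Y i j).flip y
  have hF : ∀ i x, F (DirectSum.lof Q (ZMod d) X.X i x) = tensorElem X Y i j x y := by
    intro i x
    simp [F]
  have h : ∀ v, F (totalMap X.φ v) = totalMap (tensorLeft X Y) (F v) := by
    intro v
    refine LinearMap.congr_fun (f := F ∘ₗ totalMap X.φ) (g := totalMap (tensorLeft X Y) ∘ₗ F) ?_ v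
    refine DirectSum.linearMap_ext Q fun i => LinearMap.ext fun x => ?_
    simp only [LinearMap.comp_apply]
    rw [totalMap_lof _ i (i - 1) (by ring), hF, hF, totalMap_left X Y i (i - 1) j (by ring)]
  rw [← hF, ← intertwine_iterate _ _ F h, X.total_pow]
  simp

theorem totalMap_right_pow {ζ : Q} (hζ : ζ ^ d = 1) (X : MatFac Q d f) (Y : MatFac Q d g) :
    totalMap (tensorRight ζ X Y) ^ d = g • (1 : Module.End Q (⨁ k, TensorX X Y k)) := by
  refine tensor_hom_ext X Y fun i j x y => ?_
  let F : (⨁ j, Y.X j) →ₗ[Q] ⨁ k, TensorX X Y k :=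
    DirectSum.toModule Q (ZMod d) _ fun j => tensorElem X Y i j x
  have hF : ∀ j y, F (DirectSum.lof Q (ZMod d) Y.X j y) = tensorElem X Y i j x y := by
    intro j y
    simp [F]
  have h : ∀ v, F ((ζ ^ i.val • totalMap Y.φ) v) = totalMap (tensorRight ζ X Y) (F v) := by
    intro v
    refine LinearMap.congr_fun (f := F ∘ₗ (ζ ^ i.val • totalMap Y.φ))
      (g := totalMap (tensorRight ζ X Y) ∘ₗ F) ?_ v
    refine DirectSum.linearMap_ext Q fun j => LinearMap.ext fun y => ?_
    simp only [LinearMap.comp_apply, LinearMap.smul_apply, map_smul]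
    rw [totalMap_lof _ j (j - 1) (by ring), hF, hF, totalMap_right ζ X Y i j (j - 1) (by ring)]
  rw [← hF, ← intertwine_iterate _ _ F h, smul_pow, ← pow_mul, mul_comm, pow_mul, hζ, Y.total_pow]
  simp

theorem totalMap_qcomm [NeZero d] {ζ : Q} (hζ : ζ ^ d = 1) (X : MatFac Q d f)
    (Y : MatFac Q d g) :
    totalMap (tensorLeft X Y) * totalMap (tensorRight ζ X Y) =
      ζ • (totalMap (tensorRight ζ X Y) * totalMap (tensorLeft X Y)) := by
  refine tensor_hom_ext X Y fun i j x y => ?_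
  simp only [Module.End.mul_apply, LinearMap.smul_apply]
  rw [totalMap_right ζ X Y i j (j - 1) (by ring), map_smul,
    totalMap_left X Y i (i - 1) (j - 1) (by ring), totalMap_left X Y i (i - 1) j (by ring),
    totalMap_right ζ X Y (i - 1) j (j - 1) (by ring), smul_smul,
    pow_val_succ hζ i (i - 1) (by ring)]

/-- The tensor product `X ⊗ Y` with respect to the primitive `d`-th root of unity `ζ`, with
`Φ (x ⊗ y) = φ x ⊗ y + ζ ^ |x| • (x ⊗ ψ y)`; it is a matrix factorization of `f + g`. -/
def tensor [IsDomain Q] [NeZero d] {ζ : Q} (hζ : IsPrimitiveRoot ζ d) (X : MatFac Q d f)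
    (Y : MatFac Q d g) : MatFac Q d (f + g) where
  X := TensorX X Y
  φ k l h := tensorLeft X Y k l h + tensorRight ζ X Y k l h
  total_pow := by
    have hsum : totalMap (fun k l h => tensorLeft X Y k l h + tensorRight ζ X Y k l h) =
        totalMap (tensorLeft X Y) + totalMap (tensorRight ζ X Y) := by
      refine DirectSum.linearMap_ext Q fun k => LinearMap.ext fun t => ?_
      simp only [LinearMap.comp_apply, LinearMap.add_apply]
      rw [totalMap_lof _ k (k - 1) (by ring), totalMap_lof _ k (k - 1) (by ring),
        totalMap_lof _ k (k - 1) (by ring), LinearMap.add_apply, map_add]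
    rw [hsum, add_pow_of_qcomm_primitiveRoot ζ hζ _ _ (totalMap_qcomm hζ.pow_eq_one X Y),
      totalMap_left_pow, totalMap_right_pow hζ.pow_eq_one, add_smul]

end Tensor

end MatFac

/-! ### Power series in two disjoint sets of variables -/

section PowerSeries

variable (k : Type w) [Field k] (a b : ℕ)

/-- The power series ring `k⟦x₁, …, x_n⟧`. -/
abbrev PS (n : ℕ) : Type w := MvPowerSeries (Fin n) k

/-- The power series ring `k⟦x₁, …, x_a, y₁, …, y_b⟧`. -/
abbrev PSxy : Type w := MvPowerSeries (Fin a ⊕ Fin b) k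

/-- The inclusion `k⟦x⟧ → k⟦x, y⟧`. -/
def inclX : PS k a →+* PSxy k a b := (MvPowerSeries.rename (R := k) Sum.inl).toRingHom

/-- The inclusion `k⟦y⟧ → k⟦x, y⟧`. -/
def inclY : PS k b →+* PSxy k a b := (MvPowerSeries.rename (R := k) Sum.inr).toRingHom

variable {k}

instance : IsDomain (PSxy k a b) := NoZeroDivisors.to_isDomain _

/-- The image in `k⟦x, y⟧` of a primitive root of unity of `k`. -/
theorem isPrimitiveRoot_C {ζ : k} {d : ℕ} (hζ : IsPrimitiveRoot ζ d) :
    IsPrimitiveRoot (MvPowerSeries.C ζ : PSxy k a b) d :=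
  hζ.map_of_injective (f := (MvPowerSeries.C : k →+* PSxy k a b))
    (RingHom.injective _)

variable {a b}

/-- The tensor product of `X` over `k⟦x⟧` and `Y` over `k⟦y⟧`, formed over `k⟦x, y⟧`. -/
def MatFac.tensorDisjoint {d : ℕ} [NeZero d] {ζ : k} (hζ : IsPrimitiveRoot ζ d) {f : PS k a}
    {g : PS k b} (X : MatFac (PS k a) d f) (Y : MatFac (PS k b) d g) :
    MatFac (PSxy k a b) d (inclX k a b f + inclY k a b g) :=
  (X.baseChange (inclX k a b)).tensor (isPrimitiveRoot_C a b hζ) (Y.baseChange (inclY k a b))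

end PowerSeries

end

/-! ### Direct summands and idempotent endomorphisms. -/

noncomputable section

/-! A nonzero factorization is indecomposable exactly when its only idempotent degree-zero
endomorphisms commuting with the differential are 0 and 1 (`Indecomposable.eq_zero_or_eq_one` and
`indecomposable_of_idempotents`). Over the local rings at hand all modules are free, so such an
endomorphism of `X ⊗ Y` is an idempotent matrix `E` over `k⟦x, y⟧`, cut into blocks `E i' i` indexed
by the degrees of the rank one factor. It commutes with the matrix having the `u i` next to the
diagonal and the twisted copies `ζ ^ i Ψ` on it, where `Ψ` is the matrix of `Y`
(`toMatrix_tensorDisjoint`).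

Put `y = 0`. Since `Y` is reduced, `Ψ` disappears, and commutation reads `E i' (i - 1) * u i = u (i'
+ 1) * E (i' + 1) i`. If an entry of a block `E i' i` with `i' ≠ i` were a unit, `u i` would divide
`u i'`, against coprimality. For diagonal blocks `u (i + 1)` cancels, so all of them agree at `y =
0`. Hence modulo the maximal ideal `E` is block diagonal with one repeated block, necessarily
idempotent.

Put `x = 0`. Now the `u i` disappear, and the block `H = E 0 0` commutes with `Ψ`: it is an
endomorphism of `Y`. It need not be idempotent, because the other blocks contribute to `E * E`, but
it is so modulo the maximal ideal. Newton iteration inside the polynomials in `H` converges to an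
idempotent `L` with the same constant terms (`Matrix.exists_isIdempotentElem_lift`), which still
commutes with `Ψ` and preserves degrees. Indecomposability of `Y` gives `L = 0` or `L = 1`, so `E`
is 0 or 1 modulo the maximal ideal. An idempotent matrix with vanishing constant terms is 0
(`Matrix.eq_zero_of_isIdempotentElem`); applied to `E` or `1 - E`, this finishes the proof. -/

/-- The decomposition of a module given by an idempotent endomorphism. -/
def rangeEquiv {Q M : Type*} [CommRing Q] [AddCommGroup M] [Module Q M] (p : Module.End Q M)
    (hp : ∀ x, p (p x) = p x) : M ≃ₗ[Q] LinearMap.range p × LinearMap.range (1 - p) :=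
  { p.rangeRestrict.prod (1 - p).rangeRestrict with
    invFun := fun z => z.1 + z.2
    left_inv := fun x => by
      change p x + (x - p x) = x
      abel
    right_inv := by
      rintro ⟨⟨_, x, rfl⟩, ⟨_, y, rfl⟩⟩
      refine Prod.ext (Subtype.ext ?_) (Subtype.ext ?_)
      · change p (p x + (y - p y)) = p x
        simp [hp]
      · change p x + (y - p y) - p (p x + (y - p y)) = y - p y
        simp [hp] }

namespace MatFac

section Idempotents

variable {Q : Type w} [CommRing Q] {d : ℕ} {f : Q}

/-- The direct summand of a matrix factorization cut out by an idempotent endomorphism. -/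
def ofIdempotent (X : MatFac Q d f) (p : ∀ i, Module.End Q (X.X i))
    (hp : ∀ i x, p i (p i x) = p i x)
    (hc : ∀ (i j : ZMod d) (h : i = j + 1) (x : X.X i), p j (X.φ i j h x) = X.φ i j h (p i x)) :
    MatFac Q d f where
  X i := LinearMap.range (p i)
  projective i := Module.Projective.of_split (LinearMap.range (p i)).subtype (p i).rangeRestrict <| by
    refine LinearMap.ext ?_
    rintro ⟨_, x, rfl⟩
    exact Subtype.ext (hp i x)
  φ i j h := (X.φ i j h).restrict (p := LinearMap.range (p i)) (q := LinearMap.range (p j)) <| by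
    rintro _ ⟨x, rfl⟩
    exact ⟨X.φ i j h x, hc i j h x⟩
  total_pow := by
    set Ψ := totalMap (X := fun i => LinearMap.range (p i)) (fun i j h => (X.φ i j h).restrict
      (p := LinearMap.range (p i)) (q := LinearMap.range (p j)) (by
        rintro _ ⟨x, rfl⟩
        exact ⟨X.φ i j h x, hc i j h x⟩)) with hΨ
    -- The inclusion `G` intertwines the differentials and has the left inverse `F`, so the power of
    -- the restricted differential can be computed inside `X`.
    let G : (⨁ i, LinearMap.range (p i)) →ₗ[Q] ⨁ i, X.X i :=
      DirectSum.toModule Q (ZMod d) _ fun i =>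
        DirectSum.lof Q (ZMod d) X.X i ∘ₗ (LinearMap.range (p i)).subtype
    let F : (⨁ i, X.X i) →ₗ[Q] ⨁ i, LinearMap.range (p i) :=
      DirectSum.toModule Q (ZMod d) _ fun i =>
        DirectSum.lof Q (ZMod d) (fun i => LinearMap.range (p i)) i ∘ₗ (p i).rangeRestrict
    have hFG : ∀ v, F (G v) = v := by
      intro v
      refine LinearMap.congr_fun (f := F ∘ₗ G) (g := LinearMap.id) ?_ v
      refine DirectSum.linearMap_ext Q fun i => LinearMap.ext ?_
      rintro ⟨_, x, rfl⟩
      simp only [F, G, LinearMap.comp_apply, DirectSum.toModule_lof]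
      exact congrArg _ (Subtype.ext (hp i x))
    have hG : ∀ v, G (Ψ v) = totalMap X.φ (G v) := by
      intro v
      refine LinearMap.congr_fun (f := G ∘ₗ Ψ) (g := totalMap X.φ ∘ₗ G) ?_ v
      refine DirectSum.linearMap_ext Q fun i => LinearMap.ext fun x => ?_
      simp only [LinearMap.comp_apply]
      rw [hΨ, totalMap_lof _ i (i - 1) (by ring)]
      simp only [G, DirectSum.toModule_lof, LinearMap.comp_apply]
      rw [totalMap_lof _ i (i - 1) (by ring)]
      rfl
    refine LinearMap.ext fun v => Function.LeftInverse.injective hFG ?_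
    rw [intertwine_iterate _ _ G hG, X.total_pow]
    simp

/-- The projection of the total module onto one of its graded pieces. -/
def degProj (X : MatFac Q d f) (i : ZMod d) : Module.End Q (⨁ i, X.X i) :=
  DirectSum.lof Q (ZMod d) X.X i ∘ₗ DirectSum.component Q (ZMod d) X.X i

theorem degProj_lof (X : MatFac Q d f) (i j : ZMod d) (x : X.X j) :
    X.degProj i (DirectSum.lof Q (ZMod d) X.X j x) =
      if j = i then DirectSum.lof Q (ZMod d) X.X j x else 0 := by
  split_ifs with h
  · subst h
    simp [degProj, DirectSum.component.lof_self]
  · simp [degProj, DirectSum.component.of, h]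

/-- Commuting with the degree projections makes `L` a family of idempotents `p i`. The images of `p`
and `1 - p` are complementary subfactorizations, so one of them is zero. -/
theorem Indecomposable.eq_zero_or_eq_one {X : MatFac Q d f} (hX : X.Indecomposable)
    (L : Module.End Q (⨁ i, X.X i)) (hL : IsIdempotentElem L) (hLφ : Commute L (totalMap X.φ))
    (hLd : ∀ i, Commute L (X.degProj i)) : L = 0 ∨ L = 1 := by
  let p : ∀ i, Module.End Q (X.X i) := fun i =>
    DirectSum.component Q (ZMod d) X.X i ∘ₗ L ∘ₗ DirectSum.lof Q (ZMod d) X.X i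
  have hLp : ∀ i x, L (DirectSum.lof Q (ZMod d) X.X i x) =
      DirectSum.lof Q (ZMod d) X.X i (p i x) := by
    intro i x
    have h := LinearMap.congr_fun (hLd i).eq (DirectSum.lof Q (ZMod d) X.X i x)
    simp only [Module.End.mul_apply, degProj_lof, if_true] at h
    rw [h]
    rfl
  have hinj : ∀ i, Function.Injective (DirectSum.lof Q (ZMod d) X.X i) := fun i =>
    DirectSum.of_injective i
  have hp : ∀ i x, p i (p i x) = p i x := by
    intro i x
    apply hinj i
    rw [← hLp, ← hLp, ← Module.End.mul_apply, hL.eq]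
  have hc : ∀ (i j : ZMod d) (h : i = j + 1) (x : X.X i),
      p j (X.φ i j h x) = X.φ i j h (p i x) := by
    intro i j h x
    apply hinj j
    have := LinearMap.congr_fun hLφ.eq (DirectSum.lof Q (ZMod d) X.X i x)
    simp only [Module.End.mul_apply] at this
    rwa [hLp, totalMap_lof _ i j h, totalMap_lof _ i j h, hLp] at this
  have hp' : ∀ i x, (1 - p i) ((1 - p i) x) = (1 - p i) x := by
    intro i x
    simp [hp]
  have hc' : ∀ (i j : ZMod d) (h : i = j + 1) (x : X.X i),
      (1 - p j) (X.φ i j h x) = X.φ i j h ((1 - p i) x) := by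
    intro i j h x
    simp [hc i j h]
  let e : X.Iso ((X.ofIdempotent p hp hc).directSum (X.ofIdempotent (fun i => 1 - p i) hp' hc')) :=
    { equiv := fun i => rangeEquiv (p i) (hp i)
      comm := fun i j h x => Prod.ext (Subtype.ext (hc i j h x)) (Subtype.ext (hc' i j h x)) }
  refine (hX.2 _ _ ⟨e⟩).imp (fun h => ?_) fun h => ?_
  · refine DirectSum.linearMap_ext Q fun i => LinearMap.ext fun x => ?_
    have h0 : p i x = 0 := congrArg Subtype.val
      ((h i).elim (⟨p i x, x, rfl⟩ : LinearMap.range (p i)) 0)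
    simp [hLp, h0]
  · refine DirectSum.linearMap_ext Q fun i => LinearMap.ext fun x => ?_
    have h0 : (1 - p i) x = 0 := congrArg Subtype.val
      ((h i).elim (⟨(1 - p i) x, x, rfl⟩ : LinearMap.range (1 - p i)) 0)
    have h1 : p i x = x := (sub_eq_zero.1 h0).symm
    simp [hLp, h1]

/-- A splitting into `A` and `B` yields the projection onto `A` as an idempotent; it is 0 only if
`A` is zero and 1 only if `B` is zero. -/
theorem indecomposable_of_idempotents {X : MatFac Q d f} (h0 : ¬ X.IsZero)
    (h : ∀ L : Module.End Q (⨁ i, X.X i), IsIdempotentElem L → Commute L (totalMap X.φ) →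
      (∀ i, Commute L (X.degProj i)) → L = 0 ∨ L = 1) : X.Indecomposable := by
  refine ⟨h0, ?_⟩
  rintro A B ⟨e⟩
  let α : ∀ i, X.X i ≃ₗ[Q] A.X i × B.X i := e.equiv
  have hα : ∀ i j h x, α j (X.φ i j h x) = (A.φ i j h (α i x).1, B.φ i j h (α i x).2) := e.comm
  let p : ∀ i, Module.End Q (X.X i) := fun i =>
    (α i).symm.toLinearMap ∘ₗ
      (LinearMap.inl Q (A.X i) (B.X i) ∘ₗ LinearMap.fst Q (A.X i) (B.X i)) ∘ₗ (α i).toLinearMap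
  have hep : ∀ i x, α i (p i x) = ((α i x).1, 0) := fun i x => (α i).apply_symm_apply _
  let L : Module.End Q (⨁ i, X.X i) := DirectSum.toModule Q (ZMod d) _ fun i =>
    DirectSum.lof Q (ZMod d) X.X i ∘ₗ p i
  have hL : ∀ i x, L (DirectSum.lof Q (ZMod d) X.X i x) =
      DirectSum.lof Q (ZMod d) X.X i (p i x) := fun i x => by simp [L]
  have hinj : ∀ i, Function.Injective (DirectSum.lof Q (ZMod d) X.X i) := fun i =>
    DirectSum.of_injective i
  have hcase := h L ?_ ?_ ?_
  · refine hcase.imp (fun h i => ?_) fun h i => ?_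
    · refine subsingleton_of_forall_eq 0 fun y => ?_
      have h1 := hep i ((α i).symm (y, 0))
      have h2 : p i ((α i).symm (y, 0)) = 0 := by
        apply hinj i
        rw [← hL, h]
        simp
      rw [h2, map_zero, LinearEquiv.apply_symm_apply] at h1
      exact (congrArg Prod.fst h1).symm
    · refine subsingleton_of_forall_eq 0 fun y => ?_
      have h1 := hep i ((α i).symm (0, y))
      have h2 : p i ((α i).symm (0, y)) = (α i).symm (0, y) := by
        apply hinj i
        rw [← hL, h]
        simp
      rw [h2, LinearEquiv.apply_symm_apply] at h1
      exact congrArg Prod.snd h1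
  · refine DirectSum.linearMap_ext Q fun i => LinearMap.ext fun x => ?_
    simp only [LinearMap.comp_apply, Module.End.mul_apply, hL]
    congr 1
    apply (α i).injective
    simp [hep]
  · refine DirectSum.linearMap_ext Q fun i => LinearMap.ext fun x => ?_
    simp only [LinearMap.comp_apply, Module.End.mul_apply, hL]
    rw [totalMap_lof _ i (i - 1) (by ring), totalMap_lof _ i (i - 1) (by ring), hL]
    congr 1
    apply (α (i - 1)).injective
    rw [hep, hα, hα, hep]
    simp
  · intro j
    refine DirectSum.linearMap_ext Q fun i => LinearMap.ext fun x => ?_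
    simp only [LinearMap.comp_apply, Module.End.mul_apply, hL, degProj_lof]
    split_ifs <;> simp [hL]

end Idempotents

end MatFac

/-! ### Idempotent matrices over power series rings -/

section Lifting

open MvPowerSeries

variable {σ ι k : Type*} [CommRing k]

/-- All entries of the matrix have order at least `n`. -/
def Matrix.OrderGE (n : ℕ) (M : Matrix ι ι (MvPowerSeries σ k)) : Prop :=
  ∀ i j m, m.degree < n → coeff m (M i j) = 0

namespace Matrix.OrderGE

theorem of_zero (M : Matrix ι ι (MvPowerSeries σ k)) : OrderGE 0 M :=
  fun _ _ _ h => absurd h (Nat.not_lt_zero _)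

theorem one_iff {M : Matrix ι ι (MvPowerSeries σ k)} :
    OrderGE 1 M ↔ ∀ i j, constantCoeff (M i j) = 0 := by
  refine ⟨fun h i j => by simpa using h i j 0 (by simp), fun h i j m hm => ?_⟩
  obtain rfl : m = 0 := (Finsupp.degree_eq_zero_iff m).1 (Nat.lt_one_iff.1 hm)
  simpa using h i j

theorem mono {n n' : ℕ} (h : n ≤ n') {M : Matrix ι ι (MvPowerSeries σ k)} (hM : OrderGE n' M) :
    OrderGE n M :=
  fun i j m hm => hM i j m (hm.trans_le h)

theorem eq_zero {M : Matrix ι ι (MvPowerSeries σ k)} (h : ∀ n, OrderGE (n + 1) M) : M = 0 := by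
  ext i j m
  simpa using h m.degree i j m (Nat.lt_succ_self _)

theorem add {n : ℕ} {M N : Matrix ι ι (MvPowerSeries σ k)} (hM : OrderGE n M)
    (hN : OrderGE n N) : OrderGE n (M + N) := fun i j m hm => by
  simp [hM i j m hm, hN i j m hm]

theorem sub {n : ℕ} {M N : Matrix ι ι (MvPowerSeries σ k)} (hM : OrderGE n M)
    (hN : OrderGE n N) : OrderGE n (M - N) := fun i j m hm => by
  simp [hM i j m hm, hN i j m hm]

variable [Fintype ι]

theorem mul {n n' : ℕ} {M N : Matrix ι ι (MvPowerSeries σ k)} (hM : OrderGE n M)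
    (hN : OrderGE n' N) : OrderGE (n + n') (M * N) := fun i j m hm => by
  rw [Matrix.mul_apply, map_sum]
  refine Finset.sum_eq_zero fun l _ => coeff_of_lt_order ?_
  refine lt_of_lt_of_le ?_ le_order_mul
  refine lt_of_lt_of_le (Nat.cast_lt.2 hm) ?_
  push_cast
  exact add_le_add (nat_le_order (hM i l)) (nat_le_order (hN l j))

theorem mul_left {n : ℕ} {M : Matrix ι ι (MvPowerSeries σ k)} (N : Matrix ι ι (MvPowerSeries σ k))
    (hM : OrderGE n M) : OrderGE n (N * M) := by
  simpa using (of_zero N).mul hM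

theorem mul_right {n : ℕ} {M : Matrix ι ι (MvPowerSeries σ k)}
    (N : Matrix ι ι (MvPowerSeries σ k)) (hM : OrderGE n M) : OrderGE n (M * N) := by
  simpa using hM.mul (of_zero N)

end Matrix.OrderGE

open Matrix

variable [Fintype ι]

/-- Since `M = M * M`, each multiplication by `M` raises the order by at least one, so the order of
`M` is unbounded. -/
theorem Matrix.eq_zero_of_isIdempotentElem {M : Matrix ι ι (MvPowerSeries σ k)}
    (hM : IsIdempotentElem M) (h : ∀ i j, constantCoeff (M i j) = 0) : M = 0 := by
  refine OrderGE.eq_zero fun n => ?_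
  induction n with
  | zero => exact OrderGE.one_iff.2 h
  | succ n ih => exact hM.eq ▸ ih.mul (OrderGE.one_iff.2 h)

variable [DecidableEq ι]

/-- The iterates of `H ↦ 3 H ^ 2 - 2 H ^ 3`. -/
def Matrix.idempotentApprox (H : Matrix ι ι (MvPowerSeries σ k)) :
    ℕ → Matrix ι ι (MvPowerSeries σ k)
  | 0 => H
  | n + 1 => idempotentApprox H n + (idempotentApprox H n * idempotentApprox H n -
      idempotentApprox H n) * (1 - 2 * idempotentApprox H n)

/-- The iteration squares the defect `h * h - h` up to a factor, so it converges in the order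
topology. Every iterate is a polynomial in `H`, hence the limit commutes with whatever commutes with
`H`. -/
theorem Matrix.exists_isIdempotentElem_lift (H : Matrix ι ι (MvPowerSeries σ k))
    (hH : ∀ i j, constantCoeff ((H * H - H) i j) = 0) :
    ∃ L : Matrix ι ι (MvPowerSeries σ k), IsIdempotentElem L ∧
      (∀ i j, constantCoeff (L i j) = constantCoeff (H i j)) ∧
      ∀ C, Commute C H → Commute C L := by
  set h := idempotentApprox H with hh
  have hs : ∀ n, h (n + 1) = h n + (h n * h n - h n) * (1 - 2 * h n) := fun n => rfl
  have hidem : ∀ n, OrderGE (n + 1) (h n * h n - h n) := by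
    intro n
    induction n with
    | zero => exact OrderGE.one_iff.2 hH
    | succ n ih =>
      have e : h (n + 1) * h (n + 1) - h (n + 1) =
          (h n * h n - h n) * (h n * h n - h n) * (4 * (h n * h n) - 4 * h n - 3) := by
        rw [hs]
        noncomm_ring
      rw [e]
      exact ((ih.mul ih).mul_right _).mono (by omega)
  -- The iterates form a Cauchy sequence: from the `n`-th on, coefficients of degree at most `n` no
  -- longer change.
  have hstep : ∀ n l, OrderGE (n + 1) (h (n + l) - h n) := by
    intro n l
    induction l with
    | zero => intro i j m _; simp
    | succ l ih =>
      have e : h (n + (l + 1)) - h n = (h (n + l) - h n) +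
          (h (n + l) * h (n + l) - h (n + l)) * (1 - 2 * h (n + l)) := by
        rw [← add_assoc, hs]
        abel
      rw [e]
      exact ih.add (((hidem _).mul_right _).mono (by omega))
  -- The limit: a coefficient of degree `m.degree` is already stable at the iterate of that index.
  let L : Matrix ι ι (MvPowerSeries σ k) := fun i j m => coeff m (h m.degree i j)
  have hcoeff : ∀ i j m, coeff m (L i j) = coeff m (h m.degree i j) := fun _ _ _ => rfl
  have hL : ∀ n, OrderGE (n + 1) (L - h n) := by
    intro n i j m hm
    have := hstep m.degree (n - m.degree) i j m (Nat.lt_succ_self _)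
    rw [show m.degree + (n - m.degree) = n by omega, Matrix.sub_apply, map_sub, sub_eq_zero] at this
    rw [Matrix.sub_apply, map_sub, hcoeff, this, sub_self]
  refine ⟨L, ?_, fun i j => ?_, fun C hC => ?_⟩
  · refine sub_eq_zero.1 (OrderGE.eq_zero fun n => ?_)
    have e : L * L - L = (h n * h n - h n) + (L * (L - h n) + (L - h n) * h n - (L - h n)) := by
      noncomm_ring
    rw [e]
    exact (hidem n).add ((((hL n).mul_left _).add ((hL n).mul_right _)).sub (hL n))
  · have := OrderGE.one_iff.1 (hL 0) i j
    rwa [Matrix.sub_apply, map_sub, sub_eq_zero] at this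
  · have hCh : ∀ n, Commute C (h n) := by
      intro n
      induction n with
      | zero => exact hC
      | succ n ih =>
        exact ih.add_right (((ih.mul_right ih).sub_right ih).mul_right
          ((Commute.one_right _).sub_right ((Commute.ofNat_right _ 2).mul_right ih)))
    refine sub_eq_zero.1 (OrderGE.eq_zero fun n => ?_)
    have e : C * L - L * C = C * (L - h n) - (L - h n) * C + (C * h n - h n * C) := by
      noncomm_ring
    rw [e, (hCh n).eq, sub_self, add_zero]
    exact ((hL n).mul_left _).sub ((hL n).mul_right _)

end Lifting

/-! ### Setting one set of variables to zero -/

section Restrict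

open MvPowerSeries

variable {k : Type w} [Field k]

theorem MvPowerSeries.constantCoeff_killCompl {σ τ R : Type*} [CommRing R] (e : σ ↪ τ)
    (p : MvPowerSeries τ R) : constantCoeff (killCompl e p) = constantCoeff p := by
  rw [← coeff_zero_eq_constantCoeff_apply, coeff_killCompl, Finsupp.embDomain_zero,
    coeff_zero_eq_constantCoeff_apply]

/-- A monomial in the variables of `e` that also lies in the disjoint variables of `e'` is constant,
and the constant term vanishes. -/
theorem MvPowerSeries.killCompl_rename_eq_zero {σ σ' τ R : Type*} [CommRing R] (e : σ ↪ τ)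
    (e' : σ' ↪ τ) (h : ∀ s s', e s ≠ e' s') (p : MvPowerSeries σ' R) (hp : constantCoeff p = 0) :
    killCompl e (rename e' p) = 0 := by
  ext m
  rw [coeff_killCompl, map_zero]
  by_cases hm : m = 0
  · subst hm
    rw [Finsupp.embDomain_zero, coeff_zero_eq_constantCoeff_apply, constantCoeff_rename, hp]
  · apply coeff_rename_eq_zero
    rintro ⟨m', hm'⟩
    obtain ⟨s, hs⟩ := Finsupp.ne_iff.1 hm
    have h1 : Finsupp.embDomain e m (e s) = m s := Finsupp.embDomain_apply_self ..
    rw [← hm', Finsupp.mapDomain_of_notMem_range] at h1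
    · exact hs h1.symm
    · rintro ⟨s', hs'⟩
      exact h s s' hs'.symm

variable (k)

/-- The map `k⟦x, y⟧ → k⟦x⟧` setting the `y` to zero. -/
def projX (a b : ℕ) : PSxy k a b →+* PS k a :=
  (killCompl (R := k) Function.Embedding.inl).toRingHom

/-- The map `k⟦x, y⟧ → k⟦y⟧` setting the `x` to zero. -/
def projY (a b : ℕ) : PSxy k a b →+* PS k b :=
  (killCompl (R := k) Function.Embedding.inr).toRingHom

variable {k} {a b : ℕ}

theorem projX_inclX (f : PS k a) : projX k a b (inclX k a b f) = f :=
  killCompl_rename_app (e := (Function.Embedding.inl : Fin a ↪ Fin a ⊕ Fin b)) f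

theorem projY_inclY (f : PS k b) : projY k a b (inclY k a b f) = f :=
  killCompl_rename_app (e := (Function.Embedding.inr : Fin b ↪ Fin a ⊕ Fin b)) f

theorem projX_inclY {f : PS k b} (hf : constantCoeff f = 0) :
    projX k a b (inclY k a b f) = 0 :=
  killCompl_rename_eq_zero (Function.Embedding.inl : Fin a ↪ Fin a ⊕ Fin b)
    (Function.Embedding.inr : Fin b ↪ Fin a ⊕ Fin b) (fun _ _ => Sum.inl_ne_inr) f hf

theorem projY_inclX {f : PS k a} (hf : constantCoeff f = 0) :
    projY k a b (inclX k a b f) = 0 :=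
  killCompl_rename_eq_zero (Function.Embedding.inr : Fin b ↪ Fin a ⊕ Fin b)
    (Function.Embedding.inl : Fin a ↪ Fin a ⊕ Fin b) (fun _ _ => Sum.inr_ne_inl) f hf

theorem projY_C (r : k) : projY k a b (C r) = C r :=
  killCompl_C (e := (Function.Embedding.inr : Fin b ↪ Fin a ⊕ Fin b)) r

theorem constantCoeff_projX (f : PSxy k a b) :
    constantCoeff (projX k a b f) = constantCoeff f :=
  constantCoeff_killCompl _ f

theorem constantCoeff_projY (f : PSxy k a b) :
    constantCoeff (projY k a b f) = constantCoeff f :=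
  constantCoeff_killCompl _ f

end Restrict

/-! ### Idempotents commuting with the matrix of the tensor product -/

section Core

open MvPowerSeries

variable {k : Type w} [Field k] {a b d : ℕ} {J : Type*} [Fintype J] [DecidableEq J]

/-- The matrix of the tensor product of the rank one factorization given by `u` with a
factorization of total matrix `Ψ`. -/
def tensorMatrix (ζ : k) (u : ZMod d → PS k a) (Ψ : Matrix J J (PS k b)) :
    Matrix (ZMod d × J) (ZMod d × J) (PSxy k a b) :=
  Matrix.of fun p q => (if p.1 + 1 = q.1 ∧ p.2 = q.2 then inclX k a b (u q.1) else 0) +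
    if p.1 = q.1 then (C ζ : PSxy k a b) ^ q.1.val * inclY k a b (Ψ p.2 q.2) else 0

variable [NeZero d]

theorem mul_tensorMatrix (ζ : k) (u : ZMod d → PS k a) (Ψ : Matrix J J (PS k b))
    (E : Matrix (ZMod d × J) (ZMod d × J) (PSxy k a b)) (i' i : ZMod d) (q' q : J) :
    (E * tensorMatrix ζ u Ψ) (i', q') (i, q) =
      E (i', q') (i - 1, q) * inclX k a b (u i) +
        (C ζ : PSxy k a b) ^ i.val * ∑ s, E (i', q') (i, s) * inclY k a b (Ψ s q) := by
  simp only [Matrix.mul_apply, tensorMatrix, Matrix.of_apply, mul_add, Finset.sum_add_distrib]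
  congr 1
  · rw [Finset.sum_eq_single (i - 1, q)]
    · simp
    · rintro ⟨r, s⟩ _ h
      rw [if_neg, mul_zero]
      rintro ⟨rfl, rfl⟩
      exact h (by simp)
    · simp
  · rw [Fintype.sum_prod_type, Finset.sum_eq_single i]
    · rw [Finset.mul_sum]
      refine Finset.sum_congr rfl fun s _ => ?_
      simp only [if_true]
      ring
    · intro r _ h
      simp [h]
    · simp

theorem tensorMatrix_mul (ζ : k) (u : ZMod d → PS k a) (Ψ : Matrix J J (PS k b))
    (E : Matrix (ZMod d × J) (ZMod d × J) (PSxy k a b)) (i' i : ZMod d) (q' q : J) :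
    (tensorMatrix ζ u Ψ * E) (i', q') (i, q) =
      inclX k a b (u (i' + 1)) * E (i' + 1, q') (i, q) +
        (C ζ : PSxy k a b) ^ i'.val * ∑ s, inclY k a b (Ψ q' s) * E (i', s) (i, q) := by
  simp only [Matrix.mul_apply, tensorMatrix, Matrix.of_apply, add_mul, Finset.sum_add_distrib]
  congr 1
  · rw [Finset.sum_eq_single (i' + 1, q')]
    · simp
    · rintro ⟨r, s⟩ _ h
      rw [if_neg, zero_mul]
      rintro ⟨rfl, rfl⟩
      exact h rfl
    · simp
  · rw [Fintype.sum_prod_type, Finset.sum_eq_single i']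
    · rw [Finset.mul_sum]
      refine Finset.sum_congr rfl fun s _ => ?_
      simp only [if_true]
      ring
    · intro r _ h
      simp [Ne.symm h]
    · simp

/-- The heart of the argument, in matrix form: `y = 0` controls the block structure of the constant
terms of `E`, and `x = 0` compares the common diagonal block with endomorphisms of `Y`. -/
theorem eq_zero_or_eq_one_of_commute_tensorMatrix (hd : 2 ≤ d) {ζ : k}
    {u : ZMod d → PS k a} (hu : ∀ i, constantCoeff (u i) = 0)
    (hrel : Pairwise fun i j => IsRelPrime (u i) (u j))
    {Ψ : Matrix J J (PS k b)} (hΨ : ∀ p q, constantCoeff (Ψ p q) = 0) (deg : J → ZMod d)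
    (hY : ∀ L : Matrix J J (PS k b), IsIdempotentElem L → Commute L Ψ →
      (∀ p q, deg p ≠ deg q → L p q = 0) → L = 0 ∨ L = 1)
    {E : Matrix (ZMod d × J) (ZMod d × J) (PSxy k a b)} (hE : IsIdempotentElem E)
    (hEc : Commute E (tensorMatrix ζ u Ψ))
    (hEd : ∀ p q, p.1 + deg p.2 ≠ q.1 + deg q.2 → E p q = 0) : E = 0 ∨ E = 1 := by
  have hu1 : ∀ i, ¬ IsUnit (u i) := fun i h => by
    simpa [hu i] using isUnit_iff_constantCoeff.1 h
  -- With at least two indices, `u i = 0` would make `u (i + 1)` a common divisor of `u i` and `u (i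
  -- + 1)`, hence a unit.
  have : Fact (1 < d) := ⟨hd⟩
  have hu0 : ∀ i, u i ≠ 0 := fun i h => by
    have h1 : IsRelPrime (u i) (u (i + 1)) := hrel (show i ≠ i + 1 by simp)
    rw [h] at h1
    exact hu1 _ (h1 (dvd_zero _) dvd_rfl)
  have hcomm : ∀ i' i q' q, _ := fun (i' i : ZMod d) (q' q : J) =>
    (mul_tensorMatrix ζ u Ψ E i' i q' q).symm.trans
      ((congrFun (congrFun hEc.eq (i', q')) (i, q)).trans (tensorMatrix_mul ζ u Ψ E i' i q' q))
  have hX : ∀ (i' i : ZMod d) (q' q : J), projX k a b (E (i', q') (i - 1, q)) * u i =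
      u (i' + 1) * projX k a b (E (i' + 1, q') (i, q)) := by
    intro i' i q' q
    simpa [projX_inclX, projX_inclY (hΨ _ _)] using congrArg (projX k a b) (hcomm i' i q' q)
  have hoff : ∀ (i' i : ZMod d) (q' q : J), i' ≠ i → constantCoeff (E (i', q') (i, q)) = 0 := by
    intro i' i q' q hi
    by_contra hne
    rw [← constantCoeff_projX] at hne
    -- The shift by one puts the unit entry `E i' i` beside `u i'`, so that `u i ∣ u i'`.
    have h := hX (i' - 1) i q' q
    rw [sub_add_cancel] at h
    have hdvd : u i ∣ u i' := by
      refine (isUnit_iff_constantCoeff.2 (isUnit_iff_ne_zero.2 hne)).dvd_mul_right.1 ?_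
      exact h ▸ dvd_mul_left _ _
    exact hu1 i (hrel hi hdvd dvd_rfl)
  have hdiag : ∀ (i : ZMod d) (q' q : J), constantCoeff (E (i + 1, q') (i + 1, q)) =
      constantCoeff (E (i, q') (i, q)) := by
    intro i q' q
    have h := hX i (i + 1) q' q
    rw [add_sub_cancel_right, mul_comm] at h
    rw [← constantCoeff_projX, ← mul_left_cancel₀ (hu0 _) h, constantCoeff_projX]
  have hdiag0 : ∀ (i : ZMod d) (q' q : J), constantCoeff (E (i, q') (i, q)) =
      constantCoeff (E (0, q') (0, q)) := by
    intro i q' q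
    obtain ⟨n, rfl⟩ := ZMod.natCast_zmod_surjective i
    induction n with
    | zero => simp
    | succ n ih => rw [← ih, Nat.cast_succ, hdiag]
  let H : Matrix J J (PS k b) := Matrix.of fun q' q => projY k a b (E (0, q') (0, q))
  have hHc : ∀ q' q, constantCoeff (H q' q) = constantCoeff (E (0, q') (0, q)) := fun q' q =>
    constantCoeff_projY _
  -- In the block of index 0 the twist is `ζ ^ 0 = 1`, so the commutation is untwisted.
  have hHΨ : Commute H Ψ := by
    refine Matrix.ext fun q' q => ?_
    have h := congrArg (projY k a b) (hcomm 0 0 q' q)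
    simpa [projY_inclX (hu _), projY_inclY, projY_C, Matrix.mul_apply, H] using h
  have hHidem : ∀ q' q, constantCoeff ((H * H - H) q' q) = 0 := by
    intro q' q
    have h := congrArg constantCoeff (congrFun (congrFun hE.eq (0, q')) (0, q))
    rw [Matrix.mul_apply, map_sum, Fintype.sum_prod_type, Finset.sum_eq_single 0] at h
    · rw [Matrix.sub_apply, map_sub, Matrix.mul_apply, map_sum, sub_eq_zero, hHc, ← h]
      exact Finset.sum_congr rfl fun s _ => by rw [map_mul, map_mul, hHc, hHc]
    -- The products through other blocks have constant term zero by `hoff`; this is why `H` is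
    -- idempotent only modulo the maximal ideal.
    · intro r _ hr
      exact Finset.sum_eq_zero fun s _ => by rw [map_mul, hoff 0 r _ _ hr.symm, zero_mul]
    · simp
  obtain ⟨L, hL, hLH, hLc⟩ := Matrix.exists_isIdempotentElem_lift H hHidem
  have hcase := hY L hL (hLc Ψ hHΨ.symm).symm <| by
    intro p q hpq
    -- The projector onto the degree of `p`. It commutes with `H`, hence with `L`, and this forces
    -- `L` to preserve degrees.
    let D : Matrix J J (PS k b) := Matrix.diagonal fun r => if deg r = deg p then 1 else 0
    have hD : Commute D H := by
      refine Matrix.ext fun r s => ?_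
      rw [Matrix.diagonal_mul, Matrix.mul_diagonal]
      by_cases hrs : deg r = deg s
      · rw [hrs, mul_comm]
      · have : H r s = 0 := by
          change projY k a b (E (0, r) (0, s)) = 0
          rw [hEd _ _ (by simpa using hrs), map_zero]
        rw [this, mul_zero, zero_mul]
    have h := congrFun (congrFun (hLc D hD).eq p) q
    rw [Matrix.diagonal_mul, Matrix.mul_diagonal] at h
    simpa [hpq.symm] using h
  have hEL : ∀ i' i q' q, constantCoeff (E (i', q') (i, q)) =
      if i' = i then constantCoeff (L q' q) else 0 := by
    intro i' i q' q
    split_ifs with h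
    · rw [h, hdiag0, hLH, hHc]
    · exact hoff _ _ _ _ h
  refine hcase.imp (fun h => ?_) fun h => ?_
  · refine Matrix.eq_zero_of_isIdempotentElem hE ?_
    rintro ⟨i', q'⟩ ⟨i, q⟩
    simp [hEL, h]
  · refine (sub_eq_zero.1 (Matrix.eq_zero_of_isIdempotentElem hE.one_sub ?_)).symm
    rintro ⟨i', q'⟩ ⟨i, q⟩
    rw [Matrix.sub_apply, map_sub, hEL, h]
    by_cases hi : i' = i <;> by_cases hq : q' = q <;> simp [Matrix.one_apply, hi, hq]

end Core

/-! ### Bases of total modules -/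

theorem DFinsupp.basis_apply_eq_lof {R κ : Type*} [CommRing R] [DecidableEq κ] {M : κ → Type*}
    [∀ i, AddCommGroup (M i)] [∀ i, Module R (M i)] {η : κ → Type*}
    (β : ∀ i, Module.Basis (η i) R (M i)) (i : κ) (a : η i) :
    (DFinsupp.basis β : Module.Basis (Σ i, η i) R (⨁ i, M i)) ⟨i, a⟩ =
      DirectSum.lof R κ M i (β i a) := by
  classical
  apply (DFinsupp.basis β).repr.injective
  rw [Module.Basis.repr_self]
  refine ((LinearEquiv.symm_apply_eq _).2 ?_).symm
  refine (DFinsupp.mapRange_single (f := fun i x => (β i).repr x)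
    (hf := fun i => map_zero _)).trans ?_
  rw [Module.Basis.repr_self]
  exact (sigmaFinsuppEquivDFinsupp_single (⟨i, a⟩ : Σ i, η i) (1 : R)).symm

namespace MatFac

section Bases

open Module

variable {Q : Type w} [CommRing Q] {d : ℕ} {f g : Q}

theorem toMatrix_degProj (X : MatFac Q d f) {I : Type*} [Fintype I] [DecidableEq I]
    (B : Basis I Q (⨁ i, X.X i)) (δ : I → ZMod d)
    (hB : ∀ p, ∃ x, B p = DirectSum.lof Q (ZMod d) X.X (δ p) x) (i : ZMod d) :
    LinearMap.toMatrixAlgEquiv B (X.degProj i) =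
      Matrix.diagonal fun p => if δ p = i then 1 else 0 := by
  refine (Matrix.toLinAlgEquiv B).injective ?_
  rw [Matrix.toLinAlgEquiv_toMatrixAlgEquiv]
  refine B.ext fun p => ?_
  rw [Matrix.toLinAlgEquiv_self, Finset.sum_eq_single p]
  · obtain ⟨x, hx⟩ := hB p
    rw [Matrix.diagonal_apply_eq, hx, degProj_lof]
    split_ifs <;> simp
  · intro q _ hq
    rw [Matrix.diagonal_apply_ne _ hq, zero_smul]
  · simp

/-- In a homogeneous basis the degree projections are diagonal with entries 0 and 1, so commuting
with them kills the entries between different degrees. -/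
theorem apply_eq_zero_of_commute_degProj (X : MatFac Q d f) {I : Type*} [Fintype I] [DecidableEq I]
    (B : Basis I Q (⨁ i, X.X i)) (δ : I → ZMod d)
    (hB : ∀ p, ∃ x, B p = DirectSum.lof Q (ZMod d) X.X (δ p) x)
    {L : Module.End Q (⨁ i, X.X i)} (hL : ∀ i, Commute L (X.degProj i)) {p q : I}
    (h : δ p ≠ δ q) : LinearMap.toMatrixAlgEquiv B L p q = 0 := by
  have h1 := congrFun (congrFun ((hL (δ p)).map (LinearMap.toMatrixAlgEquiv B)).eq p) q
  rw [toMatrix_degProj X B δ hB, Matrix.mul_diagonal, Matrix.diagonal_mul] at h1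
  simpa [h.symm] using h1.symm

theorem commute_degProj_of_apply_eq_zero (X : MatFac Q d f) {I : Type*} [Fintype I]
    [DecidableEq I] (B : Basis I Q (⨁ i, X.X i)) (δ : I → ZMod d)
    (hB : ∀ p, ∃ x, B p = DirectSum.lof Q (ZMod d) X.X (δ p) x)
    {M : Matrix I I Q} (hM : ∀ p q, δ p ≠ δ q → M p q = 0) (i : ZMod d) :
    Commute (Matrix.toLinAlgEquiv B M) (X.degProj i) := by
  have h : Commute M (LinearMap.toMatrixAlgEquiv B (X.degProj i)) := by
    rw [toMatrix_degProj X B δ hB]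
    refine Matrix.ext fun p q => ?_
    rw [Matrix.mul_diagonal, Matrix.diagonal_mul]
    by_cases hpq : δ p = δ q
    · rw [hpq, mul_comm]
    · rw [hM p q hpq, mul_zero, zero_mul]
  simpa using h.map (Matrix.toLinAlgEquiv B)

/-- The basis of the total module assembled from bases of the graded pieces. -/
def totalBasis (X : MatFac Q d f) {ι : ZMod d → Type*} (β : ∀ i, Basis (ι i) Q (X.X i)) :
    Basis (Σ i, ι i) Q (⨁ i, X.X i) :=
  DFinsupp.basis β

theorem totalBasis_apply (X : MatFac Q d f) {ι : ZMod d → Type*}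
    (β : ∀ i, Basis (ι i) Q (X.X i)) (i : ZMod d) (a : ι i) :
    X.totalBasis β ⟨i, a⟩ = DirectSum.lof Q (ZMod d) X.X i (β i a) :=
  DFinsupp.basis_apply_eq_lof β i a

/-- Reindexing of the basis of a tensor product whose left factor has rank one. -/
def tensorIndexEquiv (d : ℕ) (ι : ZMod d → Type*) :
    (Σ k : ZMod d, Σ p : {p : ZMod d × ZMod d // p.1 + p.2 = k}, Unit × ι p.1.2) ≃
      ZMod d × Σ j, ι j where
  toFun t := (t.2.1.1.1, ⟨t.2.1.1.2, t.2.2.2⟩)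
  invFun t := ⟨t.1 + t.2.1, ⟨(t.1, t.2.1), rfl⟩, (), t.2.2⟩
  left_inv := by
    rintro ⟨_, ⟨⟨i, j⟩, rfl⟩, ⟨⟩, a⟩
    rfl
  right_inv _ := rfl

/-- The basis of a graded piece of a tensor product induced by bases of the factors. -/
def tensorPieceBasis (X : MatFac Q d f) (Y : MatFac Q d g) {ι κ : ZMod d → Type*}
    (α : ∀ i, Basis (ι i) Q (X.X i)) (β : ∀ j, Basis (κ j) Q (Y.X j)) (k : ZMod d) :
    Basis (Σ p : {p : ZMod d × ZMod d // p.1 + p.2 = k}, ι p.1.1 × κ p.1.2) Q (TensorX X Y k) :=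
  DFinsupp.basis fun p => (α p.1.1).tensorProduct (β p.1.2)

theorem tensorPieceBasis_apply (X : MatFac Q d f) (Y : MatFac Q d g) {ι κ : ZMod d → Type*}
    (α : ∀ i, Basis (ι i) Q (X.X i)) (β : ∀ j, Basis (κ j) Q (Y.X j)) (i j k : ZMod d)
    (h : i + j = k) (a : ι i) (b : κ j) :
    tensorPieceBasis X Y α β k ⟨⟨(i, j), h⟩, (a, b)⟩ =
      tensorIncl X Y i j k h (α i a ⊗ₜ β j b) := by
  have h1 := DFinsupp.basis_apply_eq_lof
    (M := fun p : {p : ZMod d × ZMod d // p.1 + p.2 = k} => X.X p.1.1 ⊗[Q] Y.X p.1.2)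
    (fun p => (α p.1.1).tensorProduct (β p.1.2)) ⟨(i, j), h⟩ (a, b)
  rw [Basis.tensorProduct_apply] at h1
  exact h1

/-- The basis of the total module of a tensor product whose left factor has rank one. -/
def tensorBasis (X : MatFac Q d f) (Y : MatFac Q d g) {ι : ZMod d → Type*}
    (α : ∀ i, Basis Unit Q (X.X i)) (β : ∀ j, Basis (ι j) Q (Y.X j)) :
    Basis (ZMod d × Σ j, ι j) Q (⨁ k, TensorX X Y k) :=
  Basis.reindex (DFinsupp.basis (M := TensorX X Y) (tensorPieceBasis X Y α β))
    (tensorIndexEquiv d ι)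

theorem tensorBasis_apply (X : MatFac Q d f) (Y : MatFac Q d g) {ι : ZMod d → Type*}
    (α : ∀ i, Basis Unit Q (X.X i)) (β : ∀ j, Basis (ι j) Q (Y.X j)) (i j : ZMod d) (a : ι j) :
    tensorBasis X Y α β (i, ⟨j, a⟩) = tensorElem X Y i j (α i ()) (β j a) := by
  have h1 := DFinsupp.basis_apply_eq_lof (M := TensorX X Y) (tensorPieceBasis X Y α β) (i + j)
    ⟨⟨(i, j), rfl⟩, ((), a)⟩
  rw [tensorPieceBasis_apply] at h1
  rw [tensorElem_eq X Y i j _ rfl, ← h1]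
  exact Basis.reindex_apply _ _ _

theorem totalMap_tensor_elem [IsDomain Q] [NeZero d] {ζ : Q} (hζ : IsPrimitiveRoot ζ d)
    (X : MatFac Q d f) (Y : MatFac Q d g) (i j : ZMod d) (x : X.X i) (y : Y.X j) :
    totalMap (X.tensor hζ Y).φ (tensorElem X Y i j x y) =
      tensorElem X Y (i - 1) j (X.φ i (i - 1) (by ring) x) y +
        ζ ^ i.val • tensorElem X Y i (j - 1) x (Y.φ j (j - 1) (by ring) y) := by
  rw [← totalMap_left X Y i (i - 1) j (by ring), ← totalMap_right ζ X Y i j (j - 1) (by ring),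
    tensorElem_eq X Y i j _ rfl, totalMap_lof _ (i + j) (i + j - 1) (by ring),
    totalMap_lof _ (i + j) (i + j - 1) (by ring)]
  refine (totalMap_lof (X.tensor hζ Y).φ (i + j) (i + j - 1) (by ring) _).trans ?_
  exact map_add _ _ _

end Bases

/-! ### Bases under base change. -/

section BaseChange

open Module

variable {R Q : Type w} [CommRing R] [CommRing Q] {d : ℕ} {f : R} (ρ : R →+* Q)

/-- The canonical map from a matrix factorization to its base change. -/
def toBaseChange (X : MatFac R d f) (i : ZMod d) : X.X i →ₛₗ[ρ] (X.baseChange ρ).X i :=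
  letI : Algebra R Q := ρ.toAlgebra
  { toFun := fun x => (1 : Q) ⊗ₜ[R] x
    map_add' := fun x y => TensorProduct.tmul_add _ x y
    map_smul' := fun r x => by
      change (1 : Q) ⊗ₜ[R] (r • x) = ρ r • ((1 : Q) ⊗ₜ[R] x)
      rw [← TensorProduct.smul_tmul, TensorProduct.smul_tmul', Algebra.smul_def, smul_eq_mul]
      rfl }

theorem baseChange_φ_toBaseChange (X : MatFac R d f) (i j : ZMod d) (h : i = j + 1) (x : X.X i) :
    (X.baseChange ρ).φ i j h (X.toBaseChange ρ i x) = X.toBaseChange ρ j (X.φ i j h x) := by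
  let : Algebra R Q := ρ.toAlgebra
  exact LinearMap.baseChange_tmul (X.φ i j h) 1 x

/-- The basis of a base change induced by a basis. -/
def baseChangeBasis (X : MatFac R d f) (i : ZMod d) {ι : Type*} (β : Basis ι R (X.X i)) :
    Basis ι Q ((X.baseChange ρ).X i) :=
  letI : Algebra R Q := ρ.toAlgebra
  β.baseChange Q

theorem baseChangeBasis_apply (X : MatFac R d f) (i : ZMod d) {ι : Type*}
    (β : Basis ι R (X.X i)) (a : ι) :
    X.baseChangeBasis ρ i β a = X.toBaseChange ρ i (β a) := by
  let : Algebra R Q := ρ.toAlgebra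
  exact Basis.baseChange_apply Q β a

end BaseChange

end MatFac

namespace MatFac

open Module

theorem repr_lof_mem {Q : Type w} [CommRing Q] {d : ℕ} {f : Q} (X : MatFac Q d f) {I : Type*}
    (B : Basis I Q (⨁ i, X.X i)) (𝔞 : Ideal Q) (j : ZMod d) (x : X.X j)
    (hx : x ∈ 𝔞 • (⊤ : Submodule Q (X.X j))) (p : I) :
    B.repr (DirectSum.lof Q (ZMod d) X.X j x) p ∈ 𝔞 := by
  refine Submodule.smul_induction_on hx (fun r hr y _ => ?_) fun y z hy hz => ?_
  · rw [map_smul, map_smul, Finsupp.smul_apply, smul_eq_mul]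
    exact 𝔞.mul_mem_right _ hr
  · rw [map_add, map_add, Finsupp.add_apply]
    exact 𝔞.add_mem hy hz

/-- Coordinates are linear, so they send `𝔫 X` into `𝔫`; this is what makes the matrix of `Y` vanish
at `y = 0`. -/
theorem IsReduced.toMatrix_mem {Q : Type w} [CommRing Q] [IsLocalRing Q] {d : ℕ} {f : Q}
    {X : MatFac Q d f} (hX : X.IsReduced) {ι : ZMod d → Type*}
    [Fintype (Σ i, ι i)] [DecidableEq (Σ i, ι i)]
    (β : ∀ i, Basis (ι i) Q (X.X i)) (p q : Σ i, ι i) :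
    LinearMap.toMatrixAlgEquiv (X.totalBasis β) (totalMap X.φ) p q ∈
      IsLocalRing.maximalIdeal Q := by
  obtain ⟨j, a⟩ := q
  rw [LinearMap.toMatrixAlgEquiv_apply, totalBasis_apply, totalMap_lof _ j (j - 1) (by ring)]
  exact repr_lof_mem X _ _ _ _ (hX _ _ _ ⟨_, rfl⟩) p

/-! ### The matrix of the tensor product with a rank one factor. -/

section Disjoint

variable {k : Type w} [Field k] {d : ℕ} [NeZero d] {ζ : k} (hζ : IsPrimitiveRoot ζ d) {a b : ℕ}
  (u : ZMod d → PS k a) {g : PS k b} (Y : MatFac (PS k b) d g)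
  {ι : ZMod d → Type*} (β : ∀ i, Basis (ι i) (PS k b) (Y.X i))

/-- The generator of a graded piece of a factorization of rank one. -/
def rankOneGenerator (i : ZMod d) : Basis Unit (PS k a) ((rankOne u).X i) :=
  Basis.singleton Unit (PS k a)

theorem rankOne_φ_generator (i j : ZMod d) (h : i = j + 1) :
    (rankOne u).φ i j h (rankOneGenerator u i ()) = u i • rankOneGenerator u j () :=
  rfl

/-- The generator of the base change of a factorization of rank one. -/
def rankOneBasis (i : ZMod d) : Basis Unit (PSxy k a b)
    (((rankOne u).baseChange (inclX k a b)).X i) :=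
  (rankOne u).baseChangeBasis (inclX k a b) i (rankOneGenerator u i)

theorem rankOne_φ_basis (i : ZMod d) :
    ((rankOne u).baseChange (inclX k a b)).φ i (i - 1) (by ring) (rankOneBasis (b := b) u i ()) =
      inclX k a b (u i) • rankOneBasis u (i - 1) () := by
  rw [rankOneBasis, rankOneBasis, baseChangeBasis_apply, baseChangeBasis_apply,
    baseChange_φ_toBaseChange, rankOne_φ_generator, LinearMap.map_smulₛₗ]

/-- The basis of the total module of the tensor product of a factorization of rank one with `Y`. -/
def tensorDisjointBasis : Basis (ZMod d × Σ j, ι j) (PSxy k a b)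
    (⨁ l, ((rankOne u).tensorDisjoint hζ Y).X l) :=
  tensorBasis _ _ (rankOneBasis u) fun j => Y.baseChangeBasis (inclY k a b) j (β j)

theorem tensorDisjointBasis_apply (i j : ZMod d) (c : ι j) :
    tensorDisjointBasis hζ u Y β (i, ⟨j, c⟩) =
      tensorElem _ _ i j (rankOneBasis u i ()) (Y.toBaseChange (inclY k a b) j (β j c)) := by
  rw [← baseChangeBasis_apply]
  exact tensorBasis_apply _ _ _ _ i j c

theorem toMatrix_tensorDisjoint [Fintype (Σ i, ι i)] [DecidableEq (Σ i, ι i)] :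
    LinearMap.toMatrixAlgEquiv (tensorDisjointBasis hζ u Y β)
      (totalMap ((rankOne u).tensorDisjoint hζ Y).φ) =
      tensorMatrix ζ u (LinearMap.toMatrixAlgEquiv (Y.totalBasis β) (totalMap Y.φ)) := by
  set Ψ := LinearMap.toMatrixAlgEquiv (Y.totalBasis β) (totalMap Y.φ) with hΨ
  set B := tensorDisjointBasis hζ u Y β with hB
  let T := (rankOne u).tensorDisjoint hζ Y
  -- The map `v ↦ eᵢ ⊗ v`, with `eᵢ` the generator of degree `i`. It is semilinear along `inclY` and
  -- carries the expansion of `ψ` in the basis of `Y` to the tensor product.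
  have key : ∀ i : ZMod d, ∃ F : (⨁ j, Y.X j) →+ ⨁ l, T.X l,
      (∀ j y, F (DirectSum.lof (PS k b) (ZMod d) Y.X j y) =
        tensorElem _ _ i j (rankOneBasis u i ()) (Y.toBaseChange (inclY k a b) j y)) ∧
      ∀ (r : PS k b) v, F (r • v) = inclY k a b r • F v := by
    intro i
    let F : (⨁ j, Y.X j) →+ ⨁ l, T.X l := DirectSum.toAddMonoid fun j =>
      (tensorElem _ _ i j (rankOneBasis u i ())).toAddMonoidHom.comp
        (Y.toBaseChange (inclY k a b) j).toAddMonoidHom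
    have hF : ∀ j y, F (DirectSum.lof (PS k b) (ZMod d) Y.X j y) =
        tensorElem _ _ i j (rankOneBasis u i ()) (Y.toBaseChange (inclY k a b) j y) := by
      intro j y
      exact DirectSum.toAddMonoid_of _ j y
    refine ⟨F, hF, fun r v => ?_⟩
    induction v using DirectSum.induction_on with
    | zero => simp
    | of j y =>
      rw [← DirectSum.lof_eq_of (PS k b), ← map_smul, hF, hF, LinearMap.map_smulₛₗ, map_smul]
      rfl
    | add v w hv hw => rw [smul_add, map_add, hv, hw, map_add, smul_add]
  refine (Matrix.toLinAlgEquiv B).injective ?_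
  rw [Matrix.toLinAlgEquiv_toMatrixAlgEquiv]
  refine B.ext ?_
  rintro ⟨i, j, c⟩
  obtain ⟨F, hF, hFs⟩ := key i
  have hFB : ∀ q, F (Y.totalBasis β q) = B (i, q) := by
    rintro ⟨j, c⟩
    rw [totalBasis_apply, hF, hB, tensorDisjointBasis_apply]
  have hΨF : tensorElem _ _ i (j - 1) (rankOneBasis u i ())
      (Y.toBaseChange (inclY k a b) (j - 1) (Y.φ j (j - 1) (by ring) (β j c))) =
        ∑ q, inclY k a b (Ψ q ⟨j, c⟩) • B (i, q) := by
    have h1 := Matrix.toLinAlgEquiv_self (Y.totalBasis β) Ψ ⟨j, c⟩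
    rw [hΨ, Matrix.toLinAlgEquiv_toMatrixAlgEquiv, ← hΨ, totalBasis_apply,
      totalMap_lof _ j (j - 1) (by ring)] at h1
    rw [← hF, h1, map_sum]
    exact Finset.sum_congr rfl fun q _ => by rw [hFs, hFB]
  rw [Matrix.toLinAlgEquiv_self]
  have h2 : totalMap T.φ (B (i, ⟨j, c⟩)) = inclX k a b (u i) • B (i - 1, ⟨j, c⟩) +
      (MvPowerSeries.C ζ : PSxy k a b) ^ i.val • ∑ q, inclY k a b (Ψ q ⟨j, c⟩) • B (i, q) := by
    rw [← hΨF, hB, tensorDisjointBasis_apply, tensorDisjointBasis_apply]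
    refine (totalMap_tensor_elem (isPrimitiveRoot_C a b hζ) _ _ i j _ _).trans ?_
    rw [rankOne_φ_basis, baseChange_φ_toBaseChange, map_smul]
    rfl
  refine h2.trans ?_
  simp only [tensorMatrix, Matrix.of_apply, add_smul, Finset.sum_add_distrib]
  congr 1
  · rw [Finset.sum_eq_single (i - 1, ⟨j, c⟩)]
    · simp
    · rintro ⟨r, s⟩ _ h
      rw [if_neg, zero_smul]
      rintro ⟨rfl, rfl⟩
      exact h (by simp)
    · simp
  · rw [Fintype.sum_prod_type, Finset.sum_eq_single i]
    · rw [Finset.smul_sum]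
      refine Finset.sum_congr rfl fun s _ => ?_
      rw [if_pos rfl, mul_smul]
    · intro r _ h
      simp [h]
    · simp

end Disjoint

end MatFac

theorem MvPowerSeries.mem_maximalIdeal_iff {σ k : Type*} [Field k] (f : MvPowerSeries σ k) :
    f ∈ IsLocalRing.maximalIdeal (MvPowerSeries σ k) ↔ constantCoeff f = 0 := by
  rw [IsLocalRing.mem_maximalIdeal, mem_nonunits_iff, isUnit_iff_constantCoeff,
    isUnit_iff_ne_zero, not_not]

end

/-! ### From endomorphisms to matrices and back. -/

theorem theorem5p7 {k : Type w} [Field k] (d : ℕ) [NeZero d] (hd : 2 ≤ d)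
    (ζ : k) (hζ : IsPrimitiveRoot ζ d) (a b : ℕ)
    (u : ZMod d → MvPowerSeries (Fin a) k)
    (hu : ∀ i, u i ∈ IsLocalRing.maximalIdeal (MvPowerSeries (Fin a) k))
    (hrel : Pairwise fun i j => IsRelPrime (u i) (u j))
    (g : MvPowerSeries (Fin b) k) (hg0 : g ≠ 0) (hg : ¬ IsUnit g)
    (Y : MatFac (MvPowerSeries (Fin b) k) d g)
    (hYind : Y.Indecomposable) (hYred : Y.IsReduced)
    (hYT : Nonempty (Y.Iso Y.shift)) :
    ((MatFac.rankOne u).tensorDisjoint hζ Y).Indecomposable := by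
  classical
  -- Finitely generated projective modules over a local ring are free, so endomorphisms become
  -- matrices.
  have : ∀ j, Module.Free (MvPowerSeries (Fin b) k) (Y.X j) := fun j =>
    Module.free_of_flat_of_isLocalRing
  let β := fun j => Module.Free.chooseBasis (MvPowerSeries (Fin b) k) (Y.X j)
  let BY := Y.totalBasis β
  have hBY : ∀ p, ∃ y, BY p = DirectSum.lof (PS k b) (ZMod d) Y.X p.1 y := fun p =>
    ⟨_, Y.totalBasis_apply β p.1 p.2⟩
  let B := MatFac.tensorDisjointBasis hζ u Y β
  have hB : ∀ p, ∃ y, B p = DirectSum.lof (PSxy k a b) (ZMod d)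
      ((MatFac.rankOne u).tensorDisjoint hζ Y).X (p.1 + p.2.1) y := fun p =>
    ⟨_, MatFac.tensorDisjointBasis_apply hζ u Y β p.1 p.2.1 p.2.2⟩
  refine MatFac.indecomposable_of_idempotents ?_ fun L hL hLφ hLd => ?_
  · intro h
    -- Any basis vector of `Y` would give a nonzero basis vector of the tensor product, so if the
    -- latter is zero then so is `Y`.
    refine hYind.1 fun j => subsingleton_of_forall_eq 0 fun y => ?_
    refine (β j).ext_elem fun c => ?_
    obtain ⟨z, hz⟩ := hB (0, ⟨j, c⟩)
    have := h (0 + j)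
    exact absurd (hz.trans (by rw [Subsingleton.elim z 0, map_zero])) (B.ne_zero _)
  · let T := LinearMap.toMatrixAlgEquiv B
    have hT := eq_zero_or_eq_one_of_commute_tensorMatrix hd (ζ := ζ)
      (fun i => (MvPowerSeries.mem_maximalIdeal_iff _).1 (hu i)) hrel
      (Ψ := LinearMap.toMatrixAlgEquiv BY (totalMap Y.φ))
      (fun p q => (MvPowerSeries.mem_maximalIdeal_iff _).1 (hYred.toMatrix_mem β p q))
      Sigma.fst (fun M hM hMΨ hMd => ?_) (E := T L) (hL.map T) ?_ ?_
    · exact hT.imp (fun h => T.injective (h.trans (map_zero T).symm))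
        fun h => T.injective (h.trans (map_one T).symm)
    · let S := Matrix.toLinAlgEquiv BY
      refine (hYind.eq_zero_or_eq_one (S M) (hM.map S) ?_ fun i =>
        Y.commute_degProj_of_apply_eq_zero BY Sigma.fst hBY hMd i).imp
        (fun h => S.injective (h.trans (map_zero S).symm))
        fun h => S.injective (h.trans (map_one S).symm)
      simpa [S] using hMΨ.map S
    · rw [← MatFac.toMatrix_tensorDisjoint hζ u Y β]
      exact hLφ.map T
    · exact fun p q hpq => MatFac.apply_eq_zero_of_commute_degProj _ B
        (fun p => p.1 + p.2.1) hB hLd hpq
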